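/- For integers $\ell\ge 0$, $n\ge 0$ let $S_n$ be the symmetric group on $n$ elements, let $C_{\ell,n}=\{(\pi_1,\dots,\pi_\ell)\in S_n^{\ell} : \pi_j\pi_k=\pi_k\pi_j \text{ for } 1\le j,k\le \ell\}$, and put $N_\ell(n)=|C_{\ell,n}|/|S_n|$. For $n\ge 1$ let $\Delta_\ell(n)=N_\ell(n)^2-N_\ell(n-1)\,N_\ell(n+1)$. Let $p(n)$ denote the number of partitions of $n$, and for $n\ge1$ define \[ \kappa(n)=\begin{cases} 1+8\left(\dfrac{\left((n/3)!\right)^2 p(n-1)\,p(n+1)}{3^{-2n/3}}-1\right), & n\equiv 0 \pmod 3,\\[2mm] 1+8\left(\left(\left(\tfrac{n-1}{3}\right)!\,p(n)\right)^2\cdot 2\cdot 3^{2(n-1)/3}-1\right), & n\equiv 1 \pmod 3,\\[1mm] 2, & n=2,\\[1mm] 1+8\left(71\cdot 2^{(n+1)/3}\left(\tfrac{n+1}{3}\right)!\,p(n+1)-1\right), & n\equiv 2 \pmod 3,\ 2<n\le 17,\\[1mm] 1+15\left(\dfrac{3!\,6!\,7!\,2^{10}}{211}\left(\left(\dfrac{1}{6!\,2^{6}}+p(20)\right)^2+\dfrac{p(20)}{6!\,2^{5}}\right)-1\right),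 & n=20,\\[2mm] 1+8\left(97\cdot 2^{(n-2)/3}\left(\tfrac{n-2}{3}\right)!\,p(n)-1\right), & n\equiv 2 \pmod 3,\ n\ge 23. \end{cases} \] Let $n\ge 1$ and let $\ell\ge\kappa(n)$ be an integer. If $n\equiv 0\pmod 3$, then $\Delta_\ell(n)>0$. If $n\equiv 1\pmod 3$, then $\Delta_\ell(n)<0$. If $n\equiv 2\pmod 3$ and $n\ge 20$, then $\Delta_\ell(n)<0$. -/

import Mathlib

open scoped Nat

/-- The set `C_{ℓ,n}` of `ℓ`-tuples of pairwise commuting permutations of `n` elements. -/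
def commutingTuples (ℓ n : ℕ) : Set (Fin ℓ → Equiv.Perm (Fin n)) :=
  {π | ∀ j k : Fin ℓ, π j * π k = π k * π j}

/-- `N_ℓ(n) = |C_{ℓ,n}| / |S_n|`, a quotient taken in the rational numbers. -/
noncomputable def commNum (ℓ n : ℕ) : ℚ :=
  (Nat.card (commutingTuples ℓ n) : ℚ) / (Nat.card (Equiv.Perm (Fin n)) : ℚ)

/-- `Δ_ℓ(n) = N_ℓ(n)² - N_ℓ(n-1) N_ℓ(n+1)`, meant for `n ≥ 1`. -/
noncomputable def commDelta (ℓ n : ℕ) : ℚ :=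
  commNum ℓ n ^ 2 - commNum ℓ (n - 1) * commNum ℓ (n + 1)

/-- The number `p(n)` of partitions of `n`, as a rational number. -/
def partNum (n : ℕ) : ℚ := (Fintype.card (Nat.Partition n) : ℚ)

/-- The explicit threshold `κ(n)`, meant for `n ≥ 1`. The divisions by `3` in `ℕ` are all exact
in the branch in which they occur; the last branch is `n ≡ 2 (mod 3)`, `n ≥ 23`. -/
def kappa (n : ℕ) : ℚ :=
  if n % 3 = 0 then
    1 + 8 * ((((n / 3)! : ℕ) : ℚ) ^ 2 * partNum (n - 1) * partNum (n + 1)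
      / (3 : ℚ) ^ (-((2 * (n / 3) : ℕ) : ℤ)) - 1)
  else if n % 3 = 1 then
    1 + 8 * (((((n - 1) / 3)! : ℕ) * partNum n) ^ 2 * 2 * (3 : ℚ) ^ (2 * ((n - 1) / 3)) - 1)
  else if n = 2 then
    2
  else if n ≤ 17 then
    1 + 8 * (71 * (2 : ℚ) ^ ((n + 1) / 3) * (((n + 1) / 3)! : ℕ) * partNum (n + 1) - 1)
  else if n = 20 then
    1 + 15 * (((3 ! : ℕ) * (6 ! : ℕ) * (7 ! : ℕ) * (2 : ℚ) ^ 10) / 211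
      * ((1 / ((6 ! : ℕ) * (2 : ℚ) ^ 6) + partNum 20) ^ 2
        + partNum 20 / ((6 ! : ℕ) * (2 : ℚ) ^ 5)) - 1)
  else
    1 + 8 * (97 * (2 : ℚ) ^ ((n - 2) / 3) * (((n - 2) / 3)! : ℕ) * partNum n - 1)

/-!
The generating function of `N_ℓ` is `exp (∑ k, a k * q ^ k)` with `a k = g k / k`, where `g k` is
the number of subgroups of index `k` of `ℤ ^ ℓ`. Indeed commuting `ℓ`-tuples of permutations are
actions of `ℤ ^ ℓ` (`card_commutingTuples`), and classifying the orbit of a marked point by its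
stabilizer gives `n N(n) = ∑ k, g k * N(n - k)` (`homNum_recurrence`, `commNum_recurrence`). Hence
`N(n)` is a sum over the partitions of `n`, a partition with `mᵢ` parts `i` contributing
`∏ i, a i ^ mᵢ / mᵢ!` (`commNum_eq_sum`). Counting sublattices through their intersection with and
projection to the factors of `ℤ ^ ℓ × ℤ` (`subgroupNum_prod_int`) gives the exact values of `g 2`,
`g 3`, `g 4` and the bound `g k ≤ k ^ ℓ` (`latticeNum_le`).

A partition therefore contributes at most the `(ℓ - 1)`-st power of the product of its parts, and
for large `ℓ` the partitions with the largest product dominate. These products are `3 ^ k`,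
`4 * 3 ^ (k - 1)`, `2 * 3 ^ k` for `n = 3 * k`, `3 * k + 1`, `3 * k + 2` (`prod_le_maxProd`).

* For `n` congruent to `0` or `1` modulo `3`, the leading products in `N(n) ^ 2` and
  `N(n - 1) * N(n + 1)` differ by the factor `9 / 8` in one direction or the other, and Bernoulli's
  inequality turns the threshold for `ℓ` into the required lower bound for `(9 / 8) ^ (ℓ - 1)`
  (`commDelta_pos`, `commDelta_neg_one_mod`).
* For `n = 3 * k + 2` the leading products agree. As `a 4` is about `2 / 3 * a 2 ^ 2`, the
  quotient of the leading terms of `N(n - 1) * N(n + 1)` and `N(n) ^ 2` is `7 * k / (6 * (k + 1))`.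
  This is at least `49 / 48` for `k ≥ 7`, and partitions with smaller products lose a factor `8 / 9`
  in the base (`partition_two_mod`, `commDelta_neg_two_mod`).
* For `n = 20` that quotient is `1`, and the terms whose products are `8 / 9` of the maximum decide;
  all others are smaller by a factor `5 / 6` in the base (`twenty_inequality`,
  `commDelta_neg_twenty`).
-/

/-! ### Actions, orbits and stabilizers -/

/-- The number of actions of `G` on `n` labelled points, i.e. of homomorphisms from `G` to `S_n`. -/
noncomputable def homNum (G : Type*) [Group G] (n : ℕ) : ℕ :=
  Nat.card (G →* Equiv.Perm (Fin n))

/-- The number of subgroups of `G` of index `k`, meant for finitely generated `G` and `k ≥ 1`. -/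
noncomputable def subgroupNum (G : Type*) [Group G] (k : ℕ) : ℕ :=
  Nat.card {H : Subgroup G // H.index = k}

theorem finite_monoidHom_of_fg (G P : Type*) [Group G] [Group P] [Group.FG G] [Finite P] :
    Finite (G →* P) := by
  obtain ⟨S, hS⟩ := (Group.fg_def.1 ‹Group.FG G›)
  refine Finite.of_injective (fun (ρ : G →* P) (s : S) => ρ s) fun ρ η h => ?_
  refine MonoidHom.eq_of_eqOn_dense hS fun s hs => congrFun h ⟨s, hs⟩

theorem card_hom_perm (G : Type*) [Group G] (X : Type*) [Finite X] :
    Nat.card (G →* Equiv.Perm X) = homNum G (Nat.card X) := by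
  have e := Finite.equivFin X
  exact Nat.card_congr (MulEquiv.monoidHomCongrRightEquiv e.permCongrHom)

/-- An action on `X` that extends a given action on an embedded copy of `A` amounts to an action
on the complement. -/
theorem card_hom_extending {G A X : Type*} [Group G] [MulAction G A] [Finite X] (f : A ↪ X) :
    Nat.card {ρ : G →* Equiv.Perm X // ∀ g a, ρ g (f a) = f (g • a)} =
      homNum G (Nat.card X - Nat.card A) := by
  classical
  have : Finite A := Finite.of_injective f f.injective
  let Y := ↥(Set.range f)ᶜ
  let e : A ⊕ Y ≃ X := ((Equiv.ofInjective f f.injective).sumCongr (Equiv.refl Y)).trans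
    (Equiv.Set.sumCompl (Set.range f))
  have he : ∀ a, e (Sum.inl a) = f a := fun a => by
    simp only [e, Equiv.trans_apply, Equiv.sumCongr_apply, Sum.map_inl]
    exact Equiv.Set.sumCompl_apply_inl _ _
  have hY : Nat.card Y = Nat.card X - Nat.card A := by
    have := Nat.card_congr e
    rw [Nat.card_sum] at this
    omega
  rw [← hY, ← card_hom_perm]
  symm
  let F : (G →* Equiv.Perm Y) → {ρ : G →* Equiv.Perm X // ∀ g a, ρ g (f a) = f (g • a)} :=
    fun η => ⟨e.permCongrHom.toMonoidHom.comp ((Equiv.Perm.sumCongrHom A Y).comp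
      ((MulAction.toPermHom G A).prod η)), fun g a => by
        simp [Equiv.permCongrHom, Equiv.permCongr_apply, ← he]⟩
  refine Nat.card_eq_of_bijective F ⟨fun η₁ η₂ h => ?_, fun ⟨ρ, hρ⟩ => ?_⟩
  · ext1 g
    have h1 := DFunLike.congr_fun (congrArg Subtype.val h) g
    have h2 := Equiv.Perm.sumCongrHom_injective (e.permCongrHom.injective h1)
    exact congrArg Prod.snd h2
  · let ρ' : G →* Equiv.Perm (A ⊕ Y) := e.symm.permCongrHom.toMonoidHom.comp ρ
    have hρ' : ∀ g a, ρ' g (Sum.inl a) = Sum.inl (g • a) := fun g a => by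
      simp [ρ', Equiv.permCongrHom, Equiv.permCongr_apply, he, hρ, Equiv.symm_apply_eq]
    have hr : ∀ g, ∃ τ : Equiv.Perm Y,
        Equiv.Perm.sumCongrHom A Y (MulAction.toPermHom G A g, τ) = ρ' g := fun g => by
      obtain ⟨⟨σ, τ⟩, h⟩ := Equiv.Perm.mem_sumCongrHom_range_of_perm_mapsTo_inl
        (σ := ρ' g) (by rintro _ ⟨a, rfl⟩; exact ⟨g • a, (hρ' g a).symm⟩)
      refine ⟨τ, ?_⟩
      rw [← h]
      congr 2
      ext a
      have := DFunLike.congr_fun h (Sum.inl a)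
      rw [hρ'] at this
      simpa using this.symm
    choose τ hτ using hr
    have hm : ∀ g g', τ (g * g') = τ g * τ g' := fun g g' => by
      have : Equiv.Perm.sumCongrHom A Y (MulAction.toPermHom G A (g * g'), τ (g * g')) =
          Equiv.Perm.sumCongrHom A Y ((MulAction.toPermHom G A g, τ g) *
            (MulAction.toPermHom G A g', τ g')) := by
        rw [hτ, map_mul, map_mul, hτ, hτ]
      exact congrArg Prod.snd (Equiv.Perm.sumCongrHom_injective this)
    refine ⟨MonoidHom.mk' τ hm, Subtype.ext (MonoidHom.ext fun g => ?_)⟩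
    have : (F (MonoidHom.mk' τ hm)).1 g = e.permCongrHom
      (Equiv.Perm.sumCongrHom A Y (MulAction.toPermHom G A g, τ g)) := rfl
    rw [this, hτ]
    ext x
    simp [ρ', Equiv.permCongrHom, Equiv.permCongr_apply]

/-- A point of a `G`-set is the same as an equivariant embedding of a coset space `G ⧸ H`: the
subgroup `H` is the stabilizer of the point, and the image of the embedding is its orbit. -/
theorem card_equivariant_embedding {G X : Type*} [Group G] (ρ : G →* Equiv.Perm X) :
    Nat.card {p : Σ H : Subgroup G, (G ⧸ H) ↪ X // ∀ g a, ρ g (p.2 a) = p.2 (g • a)} =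
      Nat.card X := by
  refine Nat.card_eq_of_bijective (fun p => p.1.2 ((1 : G) : G ⧸ p.1.1)) ⟨?_, fun x => ?_⟩
  · rintro ⟨⟨H, f⟩, hf⟩ ⟨⟨K, f'⟩, hf'⟩ h
    dsimp only at h hf hf'
    have key : ∀ (H : Subgroup G) (f : (G ⧸ H) ↪ X), (∀ g a, ρ g (f a) = f (g • a)) →
        ∀ g : G, f (g : G ⧸ H) = ρ g (f ((1 : G) : G ⧸ H)) := fun H f hf g => by
      rw [hf, MulAction.Quotient.smul_coe, smul_eq_mul, mul_one]
    have key2 : ∀ (H : Subgroup G) (f : (G ⧸ H) ↪ X), (∀ g a, ρ g (f a) = f (g • a)) →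
        ∀ g : G, g ∈ H ↔ ρ g (f ((1 : G) : G ⧸ H)) = f ((1 : G) : G ⧸ H) := fun H f hf g => by
      rw [← key H f hf, f.injective.eq_iff, eq_comm, QuotientGroup.eq]
      simp
    obtain rfl : H = K := by
      ext g
      rw [key2 H f hf, key2 K f' hf', h]
    congr 2
    ext a
    obtain ⟨g, rfl⟩ := QuotientGroup.mk_surjective a
    rw [key H f hf, key H f' hf', h]
  · let _ : MulAction G X := MulAction.compHom X ρ
    exact ⟨⟨⟨MulAction.stabilizer G x, ⟨MulAction.ofQuotientStabilizer G x,
      MulAction.injective_ofQuotientStabilizer G x⟩⟩, fun g a =>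
        (MulAction.ofQuotientStabilizer_smul G x g a).symm⟩,
      (MulAction.ofQuotientStabilizer_mk G x 1).trans (one_smul G x)⟩

/-- A subgroup `H` of index `k` is recovered, as a stabilizer, from an action on `Fin k`
transported from `G ⧸ H` and the point corresponding to `H` itself. -/
theorem finite_subgroup_index (G : Type*) [Group G] [Group.FG G] {k : ℕ} (hk : k ≠ 0) :
    Finite {H : Subgroup G // H.index = k} := by
  have : Finite (G →* Equiv.Perm (Fin k)) := finite_monoidHom_of_fg _ _
  refine Finite.of_injective (β := (G →* Equiv.Perm (Fin k)) × Fin k) (fun H =>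
    have e := (Nat.equivFinOfCardPos (α := G ⧸ H.1) (by rw [← Subgroup.index, H.2]; exact hk)).trans
      (finCongr H.2)
    (e.permCongrHom.toMonoidHom.comp (MulAction.toPermHom G (G ⧸ H.1)), e ((1 : G) : G ⧸ H.1))) ?_
  have key : ∀ (H : {H : Subgroup G // H.index = k}) (e : G ⧸ H.1 ≃ Fin k) (g : G), g ∈ H.1 ↔
      e.permCongrHom.toMonoidHom.comp (MulAction.toPermHom G (G ⧸ H.1)) g (e ((1 : G) : G ⧸ H.1)) =
        e ((1 : G) : G ⧸ H.1) := fun H e g => by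
    simp only [Equiv.permCongrHom, MonoidHom.comp_apply, MulEquiv.coe_toMonoidHom,
      MulEquiv.coe_mk, Equiv.permCongr_apply, Equiv.symm_apply_apply, MulAction.toPermHom_apply,
      MulAction.toPerm_apply, e.injective.eq_iff, MulAction.Quotient.smul_coe, smul_eq_mul, mul_one]
    rw [eq_comm, QuotientGroup.eq]
    simp
  intro H K h
  obtain ⟨h1, h2⟩ := Prod.ext_iff.1 h
  ext g
  rw [key H _ g, key K _ g]
  dsimp only at h1 h2
  rw [h1, h2]

/-! ### The recurrence for the numbers of commuting tuples -/

/-- Both sides count pairs of an action of `G` on `n` labelled points and a point, the right side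
by the index `k` of its stabilizer. -/
theorem homNum_recurrence (G : Type*) [Group G] [Group.FG G] (n : ℕ) :
    n * homNum G n =
      ∑ k ∈ Finset.Icc 1 n, subgroupNum G k * (n.descFactorial k * homNum G (n - k)) := by
  classical
  have hfin : Finite (G →* Equiv.Perm (Fin n)) := finite_monoidHom_of_fg _ _
  let S := Σ ρ : G →* Equiv.Perm (Fin n),
    {p : Σ H : Subgroup G, (G ⧸ H) ↪ Fin n // ∀ g a, ρ g (p.2 a) = p.2 (g • a)}
  let T := Σ k : Finset.Icc 1 n, Σ H : {H : Subgroup G // H.index = k}, Σ f : (G ⧸ H.1) ↪ Fin n,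
    {ρ : G →* Equiv.Perm (Fin n) // ∀ g a, ρ g (f a) = f (g • a)}
  have hpos : ∀ ρ : G →* Equiv.Perm (Fin n), Finite
      {p : Σ H : Subgroup G, (G ⧸ H) ↪ Fin n // ∀ g a, ρ g (p.2 a) = p.2 (g • a)} := fun ρ => by
    rcases Nat.eq_zero_or_pos n with rfl | hn
    · have : IsEmpty {p : Σ H : Subgroup G, (G ⧸ H) ↪ Fin 0 //
          ∀ g a, ρ g (p.2 a) = p.2 (g • a)} := ⟨fun p => (p.1.2 ((1 : G) : G ⧸ p.1.1)).elim0⟩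
      infer_instance
    · exact Nat.finite_of_card_ne_zero (by rw [card_equivariant_embedding]; simp; omega)
  have hS : Nat.card S = n * homNum G n := by
    have := Fintype.ofFinite (G →* Equiv.Perm (Fin n))
    rw [Nat.card_sigma]
    simp_rw [card_equivariant_embedding]
    simp [homNum, mul_comm]
  have hT : Nat.card T =
      ∑ k ∈ Finset.Icc 1 n, subgroupNum G k * (n.descFactorial k * homNum G (n - k)) := by
    have hF : ∀ k : Finset.Icc 1 n, Finite {H : Subgroup G // H.index = k} := fun k =>
      finite_subgroup_index G (by have := (Finset.mem_Icc.1 k.2).1; omega)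
    have hF2 : ∀ (k : Finset.Icc 1 n) (H : {H : Subgroup G // H.index = k}),
        Finite (G ⧸ H.1) := fun k H =>
      Nat.finite_of_card_ne_zero (by
        rw [← Subgroup.index, H.2]; have := (Finset.mem_Icc.1 k.2).1; omega)
    rw [Nat.card_sigma, ← Finset.sum_coe_sort (Finset.Icc 1 n)
      (fun k => subgroupNum G k * (n.descFactorial k * homNum G (n - k)))]
    refine Finset.sum_congr rfl fun k _ => ?_
    have := Fintype.ofFinite {H : Subgroup G // H.index = k}
    rw [Nat.card_sigma, subgroupNum, Nat.card_eq_fintype_card, ← Finset.card_univ, ← smul_eq_mul,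
      ← Finset.sum_const]
    refine Finset.sum_congr rfl fun H _ => ?_
    have := Fintype.ofFinite (G ⧸ H.1)
    have hc : Fintype.card (G ⧸ H.1) = k := by
      rw [← Nat.card_eq_fintype_card, ← Subgroup.index, H.2]
    rw [Nat.card_sigma]
    simp_rw [card_hom_extending]
    rw [Finset.sum_const, Finset.card_univ, Fintype.card_embedding_eq, hc, Fintype.card_fin,
      ← Subgroup.index, H.2, Nat.card_fin, smul_eq_mul]
  rw [← hS, ← hT]
  symm
  refine Nat.card_eq_of_bijective (fun t : T => (⟨t.2.2.2.1, ⟨⟨t.2.1.1, t.2.2.1⟩, t.2.2.2.2⟩⟩ : S))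
    ⟨?_, ?_⟩
  · rintro ⟨⟨k, hk⟩, ⟨H, hH⟩, f, ⟨ρ, hρ⟩⟩ ⟨⟨k', hk'⟩, ⟨H', hH'⟩, f', ⟨ρ', hρ'⟩⟩ h
    obtain rfl : H.index = k := hH
    obtain rfl : H'.index = k' := hH'
    obtain ⟨h1, h2⟩ := Sigma.ext_iff.1 h
    dsimp only at h1 h2
    subst h1
    have h := congrArg Subtype.val (eq_of_heq h2)
    simp only [Sigma.mk.injEq] at h
    obtain ⟨rfl, h⟩ := h
    obtain rfl := eq_of_heq h
    rfl
  · rintro ⟨ρ, ⟨⟨H, f⟩, hf⟩⟩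
    have : Finite (G ⧸ H) := Finite.of_injective f f.injective
    have h1 : H.index ∈ Finset.Icc 1 n := by
      rw [Finset.mem_Icc]
      refine ⟨Nat.card_pos, ?_⟩
      simpa [Subgroup.index] using Nat.card_le_card_of_injective f f.injective
    exact ⟨⟨⟨H.index, h1⟩, ⟨H, rfl⟩, f, ⟨ρ, hf⟩⟩, rfl⟩

theorem homNum_zero (G : Type*) [Group G] : homNum G 0 = 1 := by
  have : Unique (G →* Equiv.Perm (Fin 0)) := ⟨⟨1⟩, fun _ => MonoidHom.ext fun _ =>
    Subsingleton.elim _ _⟩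
  exact Nat.card_unique

theorem card_commutingTuples (ℓ n : ℕ) :
    Nat.card (commutingTuples ℓ n) = homNum (Fin ℓ → Multiplicative ℤ) n := by
  refine Nat.card_congr (Equiv.trans ?_ (MonoidHom.noncommPiCoprodEquiv
    (N := fun _ : Fin ℓ => Multiplicative ℤ)))
  refine (Equiv.piCongrRight fun _ => zpowersHom _).subtypeEquiv fun π => ?_
  simp only [commutingTuples, Set.mem_ofPred_eq, Equiv.piCongrRight_apply, Pi.map_apply,
    zpowersHom_apply]
  refine ⟨fun h j k _ x y => (show Commute (π j) (π k) from h j k).zpow_zpow _ _,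
    fun h j k => ?_⟩
  rcases eq_or_ne j k with rfl | hjk
  · rfl
  · have := h hjk (Multiplicative.ofAdd 1) (Multiplicative.ofAdd 1)
    simpa [Commute, SemiconjBy] using this

theorem commNum_eq (ℓ n : ℕ) : commNum ℓ n = homNum (Fin ℓ → Multiplicative ℤ) n / (n ! : ℚ) := by
  rw [commNum, card_commutingTuples, Nat.card_perm, Nat.card_fin]

theorem commNum_zero (ℓ : ℕ) : commNum ℓ 0 = 1 := by
  simp [commNum_eq, homNum_zero]

theorem commNum_recurrence (ℓ n : ℕ) :
    n * commNum ℓ n =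
      ∑ k ∈ Finset.Icc 1 n, subgroupNum (Fin ℓ → Multiplicative ℤ) k * commNum ℓ (n - k) := by
  have h := homNum_recurrence (Fin ℓ → Multiplicative ℤ) n
  have h' := congrArg (Nat.cast : ℕ → ℚ) h
  push_cast at h'
  rw [commNum_eq, ← mul_div_assoc, h', Finset.sum_div]
  refine Finset.sum_congr rfl fun k hk => ?_
  have hkn := (Finset.mem_Icc.1 hk).2
  have h1 : ((n - k)! : ℚ) * (n.descFactorial k : ℚ) = n ! := by
    exact_mod_cast Nat.factorial_mul_descFactorial hkn
  have h2 : ((n - k)! : ℚ) ≠ 0 := by positivity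
  have h3 : (n ! : ℚ) ≠ 0 := by positivity
  rw [commNum_eq, ← h1, div_eq_iff (h1 ▸ h3)]
  field_simp

/-! ### Subgroups of finite index of `ℤ ^ ℓ` -/

theorem subgroupNum_congr {G G' : Type*} [Group G] [Group G'] (e : G ≃* G') (k : ℕ) :
    subgroupNum G k = subgroupNum G' k := by
  refine Nat.card_congr (e.mapSubgroup.toEquiv.subtypeEquiv fun H => ?_)
  have : (H.map e.toMonoidHom).index = H.index := H.index_map_equiv e
  change _ ↔ (H.map e.toMonoidHom).index = k
  rw [this]

theorem Subgroup.index_eq_comap_mul_map {G G' : Type*} [CommGroup G] [CommGroup G']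
    (H : Subgroup (G × G')) :
    H.index = (H.comap (MonoidHom.inl G G')).index * (H.map (MonoidHom.snd G G')).index := by
  have h1 : (MonoidHom.inl G G').range = (MonoidHom.snd G G').ker := by
    ext ⟨a, b⟩
    rw [MonoidHom.mem_range, MonoidHom.mem_ker]
    simp [eq_comm]
  have h2 : (MonoidHom.snd G G').range.index = 1 := by
    rw [MonoidHom.range_eq_top.2 Prod.snd_surjective, Subgroup.index_top]
  rw [Subgroup.index_comap, Subgroup.index_map, h1, h2, mul_one,
    ← Subgroup.relIndex_sup_left, Subgroup.relIndex_mul_index le_sup_left]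

theorem mem_of_index_multiplicative_int (D : Subgroup (Multiplicative ℤ)) (m : Multiplicative ℤ) :
    m ∈ D ↔ (D.index : ℤ) ∣ m.toAdd := by
  obtain ⟨D, rfl⟩ := AddSubgroup.toSubgroup.surjective D
  obtain ⟨a, ha⟩ := Int.subgroup_cyclic D
  rw [← AddSubgroup.zmultiples_eq_closure] at ha
  subst ha
  have : (AddSubgroup.toSubgroup (AddSubgroup.zmultiples a)).index = a.natAbs :=
    Int.index_zmultiples a
  rw [this, Int.natAbs_dvd]
  exact Int.mem_zmultiples_iff

/-- The subgroup of `G × ℤ` generated by `K` and a lift of `(c, d)`, where `c` is a coset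
of `K`. Every subgroup of finite index of `G × ℤ` arises in this way, exactly once. -/
def liftSubgroup {G : Type*} [CommGroup G] (K : Subgroup G) (c : G ⧸ K) (d : ℕ) :
    Subgroup (G × Multiplicative ℤ) where
  carrier := {x | ∃ j : ℤ, x.2 = Multiplicative.ofAdd (d * j) ∧ (x.1 : G ⧸ K) = c ^ j}
  mul_mem' := by
    rintro ⟨a, m⟩ ⟨b, m'⟩ ⟨i, hi, hi'⟩ ⟨j, hj, hj'⟩
    refine ⟨i + j, ?_, ?_⟩
    · simp only at hi hj
      rw [Prod.snd_mul, hi, hj, mul_add, ofAdd_add]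
    · simp only at hi' hj'
      rw [Prod.fst_mul, QuotientGroup.mk_mul, hi', hj', zpow_add]
  one_mem' := ⟨0, by simp⟩
  inv_mem' := by
    rintro ⟨a, m⟩ ⟨i, hi, hi'⟩
    refine ⟨-i, ?_, ?_⟩
    · simp only at hi
      rw [Prod.snd_inv, hi, mul_neg, ofAdd_neg]
    · simp only at hi'
      rw [Prod.fst_inv, QuotientGroup.mk_inv, hi', zpow_neg]

theorem mem_liftSubgroup {G : Type*} [CommGroup G] {K : Subgroup G} {c : G ⧸ K} {d : ℕ}
    {x : G × Multiplicative ℤ} : x ∈ liftSubgroup K c d ↔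
      ∃ j : ℤ, x.2 = Multiplicative.ofAdd (d * j) ∧ (x.1 : G ⧸ K) = c ^ j := Iff.rfl

theorem comap_inl_liftSubgroup {G : Type*} [CommGroup G] (K : Subgroup G) (c : G ⧸ K) {d : ℕ}
    (hd : d ≠ 0) : (liftSubgroup K c d).comap (MonoidHom.inl _ _) = K := by
  ext a
  rw [Subgroup.mem_comap, mem_liftSubgroup]
  constructor
  · rintro ⟨j, hj, hj'⟩
    have : (d * j : ℤ) = 0 := Multiplicative.ofAdd.injective hj.symm
    have : j = 0 := by simpa [hd] using this
    subst this
    exact (QuotientGroup.eq_one_iff a).1 (by simpa using hj')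
  · intro ha
    exact ⟨0, by simp, by simpa using ha⟩

theorem index_liftSubgroup {G : Type*} [CommGroup G] (K : Subgroup G) (c : G ⧸ K) {d : ℕ}
    (hd : d ≠ 0) : (liftSubgroup K c d).index = K.index * d := by
  rw [Subgroup.index_eq_comap_mul_map, comap_inl_liftSubgroup K c hd]
  congr 1
  have : (liftSubgroup K c d).map (MonoidHom.snd _ _) =
      AddSubgroup.toSubgroup (AddSubgroup.zmultiples (d : ℤ)) := by
    ext m
    have h2 : m ∈ AddSubgroup.toSubgroup (AddSubgroup.zmultiples (d : ℤ)) ↔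
      (d : ℤ) ∣ m.toAdd := Int.mem_zmultiples_iff
    rw [h2, Subgroup.mem_map]
    constructor
    · rintro ⟨⟨a, m⟩, ⟨j, hj, -⟩, rfl⟩
      exact ⟨j, congrArg Multiplicative.toAdd hj⟩
    · rintro ⟨j, hj⟩
      obtain ⟨a, ha⟩ := QuotientGroup.mk_surjective (c ^ j)
      exact ⟨(a, m), ⟨j, congrArg Multiplicative.ofAdd hj, ha⟩, rfl⟩
  rw [this]
  exact Int.index_zmultiples d

theorem eq_liftSubgroup {G : Type*} [CommGroup G] (H : Subgroup (G × Multiplicative ℤ)) :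
    ∃ c, H = liftSubgroup (H.comap (MonoidHom.inl _ _)) c (H.map (MonoidHom.snd _ _)).index := by
  set K := H.comap (MonoidHom.inl G (Multiplicative ℤ)) with hK
  set d := (H.map (MonoidHom.snd G (Multiplicative ℤ))).index with hd
  have hmem := mem_of_index_multiplicative_int (H.map (MonoidHom.snd G (Multiplicative ℤ)))
  obtain ⟨⟨v, m⟩, hv, hm⟩ := Subgroup.mem_map.1
    ((hmem (Multiplicative.ofAdd (d : ℤ))).2 (by simp [hd]))
  obtain rfl : m = Multiplicative.ofAdd (d : ℤ) := hm
  -- translating by a power of the lift moves an element with last coordinate `d * j` into `G × 1`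
  have key : ∀ (a : G) (j : ℤ), (a, Multiplicative.ofAdd (d * j : ℤ)) ∈ H ↔
      (a : G ⧸ K) = (v : G ⧸ K) ^ j := fun a j => by
    have h1 : _ ↔ (a / v ^ j, 1) ∈ H := H.mul_mem_cancel_right (H.zpow_mem hv j)
    rw [← QuotientGroup.mk_zpow, eq_comm, QuotientGroup.eq, hK, Subgroup.mem_comap,
      MonoidHom.inl_apply, inv_mul_eq_div, ← h1]
    simp [← ofAdd_zsmul, mul_comm]
  refine ⟨v, ?_⟩
  ext ⟨a, m⟩
  rw [mem_liftSubgroup]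
  constructor
  · intro h
    obtain ⟨j, hj⟩ := (hmem m).1 (Subgroup.mem_map_of_mem (MonoidHom.snd _ _) h)
    obtain rfl : m = Multiplicative.ofAdd (d * j : ℤ) := hj
    exact ⟨j, rfl, (key a j).1 h⟩
  · rintro ⟨j, hj, h⟩
    obtain rfl : m = Multiplicative.ofAdd (d * j : ℤ) := hj
    exact (key a j).2 h

theorem subgroupNum_prod_int (G : Type*) [CommGroup G] [Group.FG G] {k : ℕ} (hk : k ≠ 0) :
    subgroupNum (G × Multiplicative ℤ) k = ∑ e ∈ k.divisors, e * subgroupNum G e := by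
  have hF : ∀ e : k.divisors, Finite {H : Subgroup G // H.index = e} := fun e =>
    finite_subgroup_index G (Nat.pos_of_mem_divisors e.2).ne'
  have hF2 : ∀ (e : k.divisors) (H : {H : Subgroup G // H.index = e}), Finite (G ⧸ H.1) :=
    fun e H => Nat.finite_of_card_ne_zero (by
      rw [← Subgroup.index, H.2]; exact (Nat.pos_of_mem_divisors e.2).ne')
  have hT : Nat.card (Σ e : k.divisors, Σ K : {K : Subgroup G // K.index = e}, G ⧸ K.1) =
      ∑ e ∈ k.divisors, e * subgroupNum G e := by
    rw [Nat.card_sigma, ← Finset.sum_coe_sort k.divisors (fun e => e * subgroupNum G e)]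
    refine Finset.sum_congr rfl fun e _ => ?_
    have := Fintype.ofFinite {H : Subgroup G // H.index = e}
    rw [Nat.card_sigma, subgroupNum, Nat.card_eq_fintype_card, ← Finset.card_univ, mul_comm,
      ← smul_eq_mul, ← Finset.sum_const]
    exact Finset.sum_congr rfl fun H _ => H.2
  rw [← hT]
  symm
  have hd : ∀ e ∈ k.divisors, k / e ≠ 0 := fun e he =>
    (Nat.div_pos (Nat.divisor_le he) (Nat.pos_of_mem_divisors he)).ne'
  refine Nat.card_eq_of_bijective (fun t => ⟨liftSubgroup t.2.1.1 t.2.2 (k / t.1), by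
    rw [index_liftSubgroup _ _ (hd _ t.1.2), t.2.1.2,
      Nat.mul_div_cancel' (Nat.dvd_of_mem_divisors t.1.2)]⟩) ⟨?_, ?_⟩
  · rintro ⟨⟨e, he⟩, ⟨K, hK⟩, c⟩ ⟨⟨e', he'⟩, ⟨K', hK'⟩, c'⟩ h
    obtain rfl : K.index = e := hK
    obtain rfl : K'.index = e' := hK'
    have h := congrArg Subtype.val h
    dsimp only at h c c'
    obtain rfl : K = K' := by
      rw [← comap_inl_liftSubgroup K c (hd _ he), h, comap_inl_liftSubgroup K' c' (hd _ he')]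
    obtain rfl : c = c' := by
      obtain ⟨a, rfl⟩ := QuotientGroup.mk_surjective c
      have h1 : (a, Multiplicative.ofAdd ((k / K.index : ℕ) : ℤ)) ∈
          liftSubgroup K (a : G ⧸ K) (k / K.index) := ⟨1, by simp, by simp⟩
      rw [h] at h1
      obtain ⟨j, hj, hj'⟩ := h1
      have hj : ((k / K.index : ℕ) : ℤ) = (k / K.index : ℕ) * j := Multiplicative.ofAdd.injective hj
      have h0 : ((k / K.index : ℕ) : ℤ) ≠ 0 := by exact_mod_cast hd _ he
      have : j = 1 := by
        apply mul_left_cancel₀ h0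
        rw [← hj, mul_one]
      subst this
      simpa using hj'
    rfl
  · rintro ⟨H, hH⟩
    obtain ⟨c, hc⟩ := eq_liftSubgroup H
    have hi := Subgroup.index_eq_comap_mul_map H
    rw [hH] at hi
    have he : (H.comap (MonoidHom.inl G (Multiplicative ℤ))).index ∈ k.divisors :=
      Nat.mem_divisors.2 ⟨⟨_, hi⟩, hk⟩
    refine ⟨⟨⟨_, he⟩, ⟨_, rfl⟩, c⟩, Subtype.ext ?_⟩
    refine Eq.trans ?_ hc.symm
    dsimp only
    congr 1
    exact Nat.div_eq_of_eq_mul_right (Nat.pos_of_mem_divisors he) hi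

/-- The number of subgroups of `ℤ ^ ℓ` of index `k`. -/
noncomputable abbrev latticeNum (ℓ k : ℕ) : ℕ := subgroupNum (Fin ℓ → Multiplicative ℤ) k

theorem latticeNum_zero (k : ℕ) : latticeNum 0 k = if k = 1 then 1 else 0 := by
  rw [latticeNum, subgroupNum]
  have h : ∀ H : Subgroup (Fin 0 → Multiplicative ℤ), H.index = 1 := fun H => by
    rw [Subsingleton.elim H ⊤, Subgroup.index_top]
  split_ifs with hk
  · subst hk
    simp [h]
  · have : IsEmpty {H : Subgroup (Fin 0 → Multiplicative ℤ) // H.index = k} :=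
      ⟨fun H => hk (by rw [← H.2, h])⟩
    simp

theorem latticeNum_succ (ℓ : ℕ) {k : ℕ} (hk : k ≠ 0) :
    latticeNum (ℓ + 1) k = ∑ e ∈ k.divisors, e * latticeNum ℓ e := by
  rw [← subgroupNum_prod_int _ hk]
  let e : (Multiplicative ℤ × (Fin ℓ → Multiplicative ℤ)) ≃* (Fin (ℓ + 1) → Multiplicative ℤ) :=
    { Fin.consEquiv (fun _ : Fin (ℓ + 1) => Multiplicative ℤ) with
      map_mul' := fun x y => by
        ext i
        refine Fin.cases ?_ (fun i => ?_) i <;> simp [Fin.consEquiv] }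
  exact (subgroupNum_congr (MulEquiv.prodComm.trans e) k).symm

/-- The numbers of sublattices of `ℤ ^ ℓ` as an arithmetic function of the index. -/
noncomputable def latticeArith (ℓ : ℕ) : ArithmeticFunction ℕ :=
  ⟨fun k => if k = 0 then 0 else latticeNum ℓ k, if_pos rfl⟩

theorem latticeArith_apply (ℓ : ℕ) {k : ℕ} (hk : k ≠ 0) : latticeArith ℓ k = latticeNum ℓ k :=
  if_neg hk

theorem pmul_id_mul (f g : ArithmeticFunction ℕ) :
    ArithmeticFunction.pmul ArithmeticFunction.id (f * g) =
      ArithmeticFunction.pmul ArithmeticFunction.id f *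
        ArithmeticFunction.pmul ArithmeticFunction.id g := by
  ext n
  simp only [ArithmeticFunction.pmul_apply, ArithmeticFunction.mul_apply, Finset.mul_sum,
    ArithmeticFunction.id_apply]
  refine Finset.sum_congr rfl fun x hx => ?_
  rw [← (Nat.mem_divisorsAntidiagonal.1 hx).1]
  ring

theorem pmul_id_pow (j : ℕ) :
    ArithmeticFunction.pmul ArithmeticFunction.id (ArithmeticFunction.pow j) =
      ArithmeticFunction.pow (j + 1) := by
  ext n
  rcases eq_or_ne n 0 with rfl | hn
  · simp
  · simp [ArithmeticFunction.pow_apply, hn, pow_succ']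

theorem latticeArith_succ (ℓ : ℕ) : latticeArith (ℓ + 1) =
    ArithmeticFunction.zeta * ArithmeticFunction.pmul ArithmeticFunction.id (latticeArith ℓ) := by
  ext k
  rcases eq_or_ne k 0 with rfl | hk
  · simp
  · rw [latticeArith_apply _ hk, latticeNum_succ _ hk, ArithmeticFunction.zeta_mul_apply]
    refine Finset.sum_congr rfl fun e he => ?_
    rw [ArithmeticFunction.pmul_apply, ArithmeticFunction.id_apply,
      latticeArith_apply _ (Nat.pos_of_mem_divisors he).ne']

/-- The recursion that peels off the factor `ζ(s - ℓ)` of the subgroup zeta function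
`ζ(s) ζ(s - 1) ⋯ ζ(s - ℓ)` of `ℤ ^ (ℓ + 1)`, in place of the factor `ζ(s)`. -/
theorem latticeArith_succ' (ℓ : ℕ) :
    latticeArith (ℓ + 1) = latticeArith ℓ * ArithmeticFunction.pow ℓ := by
  induction ℓ with
  | zero =>
    have h : latticeArith 0 = 1 := by
      ext k
      rcases eq_or_ne k 0 with rfl | hk
      · simp
      · rw [latticeArith_apply _ hk, latticeNum_zero, ArithmeticFunction.one_apply]
    have h1 : ArithmeticFunction.pmul ArithmeticFunction.id (1 : ArithmeticFunction ℕ) = 1 := by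
      ext k
      rcases eq_or_ne k 1 with rfl | hk
      · simp
      · simp [hk]
    rw [latticeArith_succ, h, h1, mul_one, one_mul, ArithmeticFunction.pow_zero_eq_zeta]
  | succ ℓ ih =>
    rw [latticeArith_succ (ℓ + 1)]
    conv_lhs => rw [ih]
    rw [pmul_id_mul, pmul_id_pow, ← mul_assoc, ← latticeArith_succ]

/-- In the recursion `latticeArith_succ'` each divisor of `k` contributes at most `k ^ ℓ`, and `k` has at
most `k` divisors. The recursion `latticeNum_succ` would give a weaker bound. -/
theorem latticeNum_le (ℓ : ℕ) {k : ℕ} (hk : k ≠ 0) : latticeNum ℓ k ≤ k ^ ℓ := by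
  induction ℓ generalizing k with
  | zero => rw [latticeNum_zero]; split_ifs <;> simp
  | succ ℓ ih =>
    rw [← latticeArith_apply _ hk, latticeArith_succ', ArithmeticFunction.mul_apply]
    have : ∀ x ∈ k.divisorsAntidiagonal,
        latticeArith ℓ x.1 * ArithmeticFunction.pow ℓ x.2 ≤ k ^ ℓ := fun x hx => by
      have h := (Nat.mem_divisorsAntidiagonal.1 hx).1
      have h1 : x.1 ≠ 0 := fun h0 => hk (by rw [← h, h0, zero_mul])
      rw [latticeArith_apply _ h1, ← h, mul_pow, ArithmeticFunction.pow_apply]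
      refine Nat.mul_le_mul (ih h1) ?_
      split_ifs <;> simp
    refine (Finset.sum_le_card_nsmul _ _ _ this).trans ?_
    rw [smul_eq_mul, pow_succ', ← Nat.map_div_right_divisors, Finset.card_map]
    exact Nat.mul_le_mul_right _ (Nat.card_divisors_le_self k)

theorem latticeNum_one (ℓ : ℕ) : latticeNum ℓ 1 = 1 := by
  induction ℓ with
  | zero => simp [latticeNum_zero]
  | succ ℓ ih => rw [latticeNum_succ _ one_ne_zero]; simpa using ih

theorem latticeNum_prime (ℓ : ℕ) {p : ℕ} (hp : p.Prime) :
    (p - 1 : ℚ) * latticeNum ℓ p = p ^ ℓ - 1 := by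
  induction ℓ with
  | zero => simp [latticeNum_zero, hp.ne_one]
  | succ ℓ ih =>
    rw [latticeNum_succ _ hp.ne_zero, hp.divisors, Finset.sum_pair hp.ne_one.symm, latticeNum_one]
    push_cast
    rw [mul_add, mul_left_comm, ih]
    ring

theorem latticeNum_four (ℓ : ℕ) :
    (3 : ℚ) * latticeNum ℓ 4 = (2 * 2 ^ ℓ - 1) * (2 ^ ℓ - 1) := by
  induction ℓ with
  | zero => simp [latticeNum_zero]
  | succ ℓ ih =>
    have h2 := latticeNum_prime ℓ Nat.prime_two
    have h4 : Nat.divisors 4 = {1, 2, 4} := by decide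
    rw [latticeNum_succ _ (by norm_num), h4, Finset.sum_insert (by decide),
      Finset.sum_pair (by decide), latticeNum_one]
    push_cast at h2 ⊢
    linear_combination 4 * ih + 6 * h2

/-! ### The expansion over partitions -/

/-- The contribution `∏ i, a i ^ mᵢ / mᵢ!` of a partition with `mᵢ` parts equal to `i` to the
coefficients of `exp (∑ i, a i * q ^ i)`. -/
def partWeight (a : ℕ → ℚ) (s : Multiset ℕ) : ℚ :=
  ∏ i ∈ s.toFinset, a i ^ s.count i / (s.count i)!

/-- The partitions of `n`, as a finite set of multisets. -/
def partitions (n : ℕ) : Finset (Multiset ℕ) :=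
  Finset.univ.image (Nat.Partition.parts (n := n))

theorem mem_partitions {n : ℕ} {s : Multiset ℕ} :
    s ∈ partitions n ↔ s.sum = n ∧ ∀ i ∈ s, 0 < i := by
  simp only [partitions, Finset.mem_image, Finset.mem_univ, true_and]
  constructor
  · rintro ⟨p, rfl⟩
    exact ⟨p.parts_sum, fun i hi => p.parts_pos hi⟩
  · rintro ⟨h1, h2⟩
    exact ⟨⟨s, fun {i} hi => h2 i hi, h1⟩, rfl⟩

theorem card_partitions (n : ℕ) : ((partitions n).card : ℚ) = partNum n := by
  rw [partitions, Finset.card_image_of_injective, Finset.card_univ, partNum]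
  intro p q h
  exact Nat.Partition.ext h

theorem partWeight_eq_prod (a : ℕ → ℚ) {s : Multiset ℕ} {F : Finset ℕ} (h : s.toFinset ⊆ F) :
    partWeight a s = ∏ i ∈ F, a i ^ s.count i / (s.count i)! :=
  Finset.prod_subset h fun i _ hi => by
    rw [Multiset.count_eq_zero.2 (by simpa using hi)]
    simp

theorem partWeight_cons (a : ℕ → ℚ) (k : ℕ) (t : Multiset ℕ) :
    ((k ::ₘ t).count k : ℚ) * partWeight a (k ::ₘ t) = a k * partWeight a t := by
  have hF : t.toFinset ⊆ insert k t.toFinset := Finset.subset_insert _ _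
  rw [partWeight_eq_prod a (s := k ::ₘ t) (F := insert k t.toFinset) (by simp),
    partWeight_eq_prod a hF, ← Finset.mul_prod_erase _ _ (Finset.mem_insert_self k _),
    ← Finset.mul_prod_erase _ (fun i => a i ^ t.count i / _) (Finset.mem_insert_self k _),
    ← mul_assoc, ← mul_assoc]
  congr 1
  · rw [Multiset.count_cons_self, Nat.factorial_succ]
    have : ((t.count k)! : ℚ) ≠ 0 := by positivity
    push_cast
    field_simp
    rw [pow_succ']
  · refine Finset.prod_congr rfl fun i hi => ?_
    rw [Multiset.count_cons_of_ne (Finset.ne_of_mem_erase hi)]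

/-- Euler's identity `n N(n) = ∑ k, k a(k) N(n - k)` determines `N`; this is the exponential
formula `∑ n, N(n) q ^ n = exp (∑ k, a(k) q ^ k)`, expanded over partitions. -/
theorem eq_sum_partWeight {a N : ℕ → ℚ} (h0 : N 0 = 1)
    (h : ∀ n : ℕ, n * N n = ∑ k ∈ Finset.Icc 1 n, k * a k * N (n - k)) (n : ℕ) :
    N n = ∑ s ∈ partitions n, partWeight a s := by
  induction n using Nat.strong_induction_on with
  | _ n ih =>
  rcases Nat.eq_zero_or_pos n with rfl | hn
  · have : partitions 0 = {0} := by
      ext s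
      rw [mem_partitions, Finset.mem_singleton]
      refine ⟨fun ⟨h1, h2⟩ => Multiset.eq_zero_of_forall_notMem fun i hi => ?_,
        fun h => by simp [h]⟩
      have := Multiset.single_le_sum (fun _ _ => Nat.zero_le _) i hi
      have := h2 i hi
      omega
    rw [this, h0]
    simp [partWeight]
  · have hn' : (n : ℚ) ≠ 0 := by positivity
    apply mul_left_cancel₀ hn'
    have h1 : ∀ s ∈ partitions n, (n : ℚ) * partWeight a s =
        ∑ k ∈ s.toFinset, (k : ℚ) * a k * partWeight a (s.erase k) := fun s hs => by
      have h2 : (n : ℚ) = ∑ k ∈ s.toFinset, (s.count k : ℚ) * k := by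
        rw [← (mem_partitions.1 hs).1, Finset.sum_multiset_count]
        push_cast
        simp
      rw [h2, Finset.sum_mul]
      refine Finset.sum_congr rfl fun k hk => ?_
      have := partWeight_cons a k (s.erase k)
      rw [Multiset.cons_erase (Multiset.mem_toFinset.1 hk)] at this
      rw [mul_right_comm, this]
      ring
    rw [h, Finset.mul_sum, Finset.sum_congr rfl h1, Finset.sum_sigma']
    have h3 : ∀ k ∈ Finset.Icc 1 n, (k : ℚ) * a k * N (n - k) =
        ∑ t ∈ partitions (n - k), (k : ℚ) * a k * partWeight a t := fun k hk => by
      rw [ih _ (by have := Finset.mem_Icc.1 hk; omega), Finset.mul_sum]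
    rw [Finset.sum_congr rfl h3, Finset.sum_sigma']
    refine Finset.sum_bij' (fun x _ => ⟨x.1 ::ₘ x.2, x.1⟩) (fun x _ => ⟨x.2, x.1.erase x.2⟩)
      ?_ ?_ ?_ ?_ ?_
    · rintro ⟨k, t⟩ hx
      simp only [Finset.mem_sigma, Finset.mem_Icc, mem_partitions] at hx ⊢
      refine ⟨⟨by rw [Multiset.sum_cons]; omega, fun i hi => ?_⟩, by simp⟩
      rcases Multiset.mem_cons.1 hi with rfl | hi
      · omega
      · exact hx.2.2 i hi
    · rintro ⟨s, k⟩ hx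
      simp only [Finset.mem_sigma, Finset.mem_Icc, mem_partitions, Multiset.mem_toFinset] at hx ⊢
      have hc := Multiset.sum_erase hx.2
      have := hx.1.2 k hx.2
      exact ⟨⟨by omega, by omega⟩, by omega, fun i hi => hx.1.2 i (Multiset.mem_of_mem_erase hi)⟩
    · rintro ⟨k, t⟩ hx
      simp
    · rintro ⟨s, k⟩ hx
      simp only [Finset.mem_sigma, Multiset.mem_toFinset] at hx
      simp [Multiset.cons_erase hx.2]
    · rintro ⟨k, t⟩ hx
      simp

theorem partWeight_nonneg {a : ℕ → ℚ} (ha : ∀ i, 0 ≤ a i) (s : Multiset ℕ) :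
    0 ≤ partWeight a s :=
  Finset.prod_nonneg fun i _ => div_nonneg (pow_nonneg (ha i) _) (by positivity)

theorem partWeight_le {a : ℕ → ℚ} (ha : ∀ i, 0 ≤ a i) {r : ℕ} (har : ∀ i, 0 < i → a i ≤ i ^ r)
    {s : Multiset ℕ} (hs : ∀ i ∈ s, 0 < i) : partWeight a s ≤ (s.prod : ℚ) ^ r := by
  rw [Finset.prod_multiset_count s, Nat.cast_prod, ← Finset.prod_pow]
  refine Finset.prod_le_prod (fun i _ => div_nonneg (pow_nonneg (ha i) _) (by positivity))
    fun i hi => ?_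
  rw [Nat.cast_pow, ← pow_mul, mul_comm, pow_mul]
  refine (div_le_self (pow_nonneg (ha i) _) ?_).trans
    (pow_le_pow_left₀ (ha i) (har i (hs i (Multiset.mem_toFinset.1 hi))) _)
  exact_mod_cast Nat.factorial_pos _

/-- The weight of the partition with `x` parts `2`, `y` parts `3` and `z` parts `4`. -/
theorem partWeight_replicate (a : ℕ → ℚ) (x y z : ℕ) :
    partWeight a (Multiset.replicate x 2 + Multiset.replicate y 3 + Multiset.replicate z 4) =
      a 2 ^ x / x ! * (a 3 ^ y / y !) * (a 4 ^ z / z !) := by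
  rw [partWeight_eq_prod a (F := {2, 3, 4})]
  · rw [Finset.prod_insert (by decide), Finset.prod_insert (by decide), Finset.prod_singleton]
    simp [Multiset.count_replicate, mul_assoc]
  · intro i hi
    simp only [Multiset.mem_toFinset, Multiset.mem_add, Multiset.mem_replicate] at hi
    simp only [Finset.mem_insert, Finset.mem_singleton]
    omega

/-- `a_ℓ(k)`: the number of sublattices of `ℤ ^ ℓ` of index `k`, divided by `k`. -/
noncomputable def latticeRatio (ℓ k : ℕ) : ℚ := latticeNum ℓ k / k

theorem commNum_eq_sum (ℓ n : ℕ) :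
    commNum ℓ n = ∑ s ∈ partitions n, partWeight (latticeRatio ℓ) s := by
  refine eq_sum_partWeight (commNum_zero ℓ) (fun n => ?_) n
  rw [commNum_recurrence]
  refine Finset.sum_congr rfl fun k hk => ?_
  have : (k : ℚ) ≠ 0 := by have := (Finset.mem_Icc.1 hk).1; positivity
  rw [latticeRatio, mul_div_cancel₀ _ this]

theorem latticeRatio_nonneg (ℓ k : ℕ) : 0 ≤ latticeRatio ℓ k := by
  unfold latticeRatio; positivity

theorem latticeRatio_le (r k : ℕ) (hk : 0 < k) : latticeRatio (r + 1) k ≤ k ^ r := by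
  have : (0 : ℚ) < k := by positivity
  rw [latticeRatio, div_le_iff₀ this, ← pow_succ]
  exact_mod_cast latticeNum_le (r + 1) hk.ne'

theorem latticeRatio_two (r : ℕ) : latticeRatio (r + 1) 2 = 2 ^ r - 1 / 2 := by
  have := latticeNum_prime (r + 1) Nat.prime_two
  rw [latticeRatio]
  push_cast at this ⊢
  rw [pow_succ] at this
  linarith

theorem latticeRatio_three (r : ℕ) : latticeRatio (r + 1) 3 = 3 ^ r / 2 - 1 / 6 := by
  have := latticeNum_prime (r + 1) Nat.prime_three
  rw [latticeRatio]
  push_cast at this ⊢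
  rw [pow_succ] at this
  linarith

theorem latticeRatio_four (r : ℕ) : latticeRatio (r + 1) 4 =
    2 / 3 * latticeRatio (r + 1) 2 ^ 2 + latticeRatio (r + 1) 2 / 6 := by
  have := latticeNum_four (r + 1)
  rw [latticeRatio_two, latticeRatio]
  push_cast at this ⊢
  rw [pow_succ] at this
  linarith

theorem commNum_nonneg (ℓ n : ℕ) : 0 ≤ commNum ℓ n := by
  rw [commNum]; positivity

/-- Lower bound by the partitions into parts `2`, `3`, `4` listed in `F` as triples of
multiplicities. -/
theorem sum_le_commNum (ℓ n : ℕ) (F : Finset (ℕ × ℕ × ℕ))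
    (hF : ∀ x ∈ F, 2 * x.1 + 3 * x.2.1 + 4 * x.2.2 = n) :
    ∑ x ∈ F, latticeRatio ℓ 2 ^ x.1 / x.1 ! * (latticeRatio ℓ 3 ^ x.2.1 / x.2.1 !) *
      (latticeRatio ℓ 4 ^ x.2.2 / x.2.2 !) ≤ commNum ℓ n := by
  classical
  let m : ℕ × ℕ × ℕ → Multiset ℕ := fun x =>
    Multiset.replicate x.1 2 + Multiset.replicate x.2.1 3 + Multiset.replicate x.2.2 4
  -- the multiplicities can be read off the multiset
  have hm : Function.Injective m := fun x y h => by
    have h2 := congrArg (Multiset.count 2) h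
    have h3 := congrArg (Multiset.count 3) h
    have h4 := congrArg (Multiset.count 4) h
    simp [m, Multiset.count_replicate] at h2 h3 h4
    exact Prod.ext h2 (Prod.ext h3 h4)
  rw [commNum_eq_sum]
  simp_rw [← partWeight_replicate]
  rw [← Finset.sum_image (f := partWeight (latticeRatio ℓ)) (g := m) hm.injOn]
  refine Finset.sum_le_sum_of_subset_of_nonneg ?_
    fun s _ _ => partWeight_nonneg (latticeRatio_nonneg ℓ) s
  intro s hs
  obtain ⟨x, hx, rfl⟩ := Finset.mem_image.1 hs
  rw [mem_partitions]
  constructor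
  · rw [← hF x hx]
    simp [m]
    ring
  · intro i hi
    simp only [m, Multiset.mem_add, Multiset.mem_replicate] at hi
    omega

/-- Upper bound: apart from the partitions into parts `2`, `3`, `4` listed in `F`, each partition
is estimated by the product of its parts. -/
theorem commNum_le_sum (r n : ℕ) (F : Finset (ℕ × ℕ × ℕ)) {M : ℚ} (hM : 0 ≤ M)
    (hF : ∀ s ∈ partitions n, (∃ x ∈ F, s = Multiset.replicate x.1 2 +
      Multiset.replicate x.2.1 3 + Multiset.replicate x.2.2 4) ∨ (s.prod : ℚ) ≤ M) :
    commNum (r + 1) n ≤ ∑ x ∈ F, latticeRatio (r + 1) 2 ^ x.1 / x.1 ! *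
      (latticeRatio (r + 1) 3 ^ x.2.1 / x.2.1 !) * (latticeRatio (r + 1) 4 ^ x.2.2 / x.2.2 !) +
        partNum n * M ^ r := by
  classical
  let m : ℕ × ℕ × ℕ → Multiset ℕ := fun x =>
    Multiset.replicate x.1 2 + Multiset.replicate x.2.1 3 + Multiset.replicate x.2.2 4
  have hw := partWeight_nonneg (latticeRatio_nonneg (r + 1))
  rw [commNum_eq_sum, ← Finset.sum_filter_add_sum_filter_not _ (fun s => s ∈ F.image m)]
  refine add_le_add ?_ ?_
  · simp_rw [← partWeight_replicate]
    refine (Finset.sum_le_sum_of_subset_of_nonneg (t := F.image m)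
      (fun s hs => (Finset.mem_filter.1 hs).2) fun s _ _ => hw s).trans ?_
    exact Finset.sum_image_le_of_nonneg fun s _ => hw s
  · refine (Finset.sum_le_card_nsmul _ _ (M ^ r) fun s hs => ?_).trans ?_
    · obtain ⟨hs, hs'⟩ := Finset.mem_filter.1 hs
      refine (partWeight_le (latticeRatio_nonneg _) (latticeRatio_le r)
        (mem_partitions.1 hs).2).trans ?_
      refine pow_le_pow_left₀ (by positivity) ?_ _
      rcases hF s hs with ⟨x, hx, rfl⟩ | h
      · exact absurd (Finset.mem_image_of_mem m hx) hs'
      · exact h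
    · rw [nsmul_eq_mul, ← card_partitions]
      gcongr
      exact Finset.filter_subset _ _

/-! ### Products of the parts of a partition -/

/-- The largest product of positive integers with sum `n`, except that `maxProd 1 = 4 / 3`: it is
`3 ^ k`, `4 * 3 ^ (k - 1)`, `2 * 3 ^ k` for `n = 3 * k`, `3 * k + 1`, `3 * k + 2`. -/
def maxProd (n : ℕ) : ℚ :=
  3 ^ (n / 3) * (if n % 3 = 0 then 1 else if n % 3 = 1 then 4 / 3 else 2)

theorem maxProd_add_three (n : ℕ) : maxProd (n + 3) = 3 * maxProd n := by
  rw [maxProd, maxProd, Nat.add_div_right _ (by norm_num), Nat.add_mod_right, pow_succ']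
  ring

theorem maxProd_pos (n : ℕ) : 0 < maxProd n := by
  rw [maxProd]; split_ifs <;> positivity

theorem maxProd_mul_le (i j : ℕ) : maxProd i * maxProd j ≤ maxProd (i + j) := by
  induction i using Nat.strong_induction_on with
  | _ i ih =>
  rcases Nat.lt_or_ge i 3 with hi | hi
  · clear ih
    induction j using Nat.strong_induction_on with
    | _ j ihj =>
    rcases Nat.lt_or_ge j 3 with hj | hj
    · interval_cases i <;> interval_cases j <;> norm_num [maxProd]
    · obtain ⟨j, rfl⟩ := Nat.exists_eq_add_of_le' hj
      have := ihj j (by omega)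
      rw [← add_assoc, maxProd_add_three, maxProd_add_three]
      linarith
  · obtain ⟨i, rfl⟩ := Nat.exists_eq_add_of_le' hi
    have := ih i (by omega)
    rw [add_right_comm, maxProd_add_three, maxProd_add_three]
    linarith

theorem le_maxProd (i : ℕ) : (i : ℚ) ≤ maxProd i := by
  induction i using Nat.strong_induction_on with
  | _ i ih =>
  rcases Nat.lt_or_ge i 5 with hi | hi
  · interval_cases i <;> norm_num [maxProd]
  · obtain ⟨i, rfl⟩ := Nat.exists_eq_add_of_le' (show 3 ≤ i by omega)
    have := ih i (by omega)
    have h2 : (2 : ℚ) ≤ i := by exact_mod_cast (show 2 ≤ i by omega)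
    rw [maxProd_add_three]
    push_cast
    linarith

theorem le_maxProd_of_five_le {i : ℕ} (hi : 5 ≤ i) : (i : ℚ) ≤ 5 / 6 * maxProd i := by
  induction i using Nat.strong_induction_on with
  | _ i ih =>
  rcases Nat.lt_or_ge i 8 with hi' | hi'
  · interval_cases i <;> norm_num [maxProd]
  · obtain ⟨i, rfl⟩ := Nat.exists_eq_add_of_le' (show 3 ≤ i by omega)
    have := ih i (by omega) (by omega)
    have h2 : (2 : ℚ) ≤ i := by exact_mod_cast (show 2 ≤ i by omega)
    rw [maxProd_add_three]
    push_cast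
    linarith

theorem prod_le_maxProd (s : Multiset ℕ) : (s.prod : ℚ) ≤ maxProd s.sum := by
  induction s using Multiset.induction with
  | empty => simp [maxProd]
  | cons i s ih =>
    rw [Multiset.prod_cons, Multiset.sum_cons, Nat.cast_mul]
    exact (mul_le_mul (le_maxProd i) ih (by positivity) (maxProd_pos i).le).trans
      (maxProd_mul_le i _)

theorem maxProd_one_mod (k : ℕ) : maxProd (3 * k + 1) = 3 ^ k * (4 / 3) := by
  rw [maxProd, show (3 * k + 1) / 3 = k by omega, show (3 * k + 1) % 3 = 1 by omega]
  norm_num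

theorem maxProd_two_mod (k : ℕ) : maxProd (3 * k + 2) = 3 ^ k * 2 := by
  rw [maxProd, show (3 * k + 2) / 3 = k by omega, show (3 * k + 2) % 3 = 2 by omega]
  norm_num

/-- A multiset with entries in `{2, 3, 4}` is determined by the multiplicities. -/
theorem eq_replicate_of_mem {s : Multiset ℕ} (h : ∀ i ∈ s, i = 2 ∨ i = 3 ∨ i = 4) :
    ∃ x y z, s = Multiset.replicate x 2 + Multiset.replicate y 3 + Multiset.replicate z 4 := by
  refine ⟨s.count 2, s.count 3, s.count 4, Multiset.ext.2 fun i => ?_⟩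
  simp only [Multiset.count_add, Multiset.count_replicate]
  by_cases hi : i ∈ s
  · rcases h i hi with rfl | rfl | rfl <;> simp
  · rw [Multiset.count_eq_zero.2 hi]
    have : ∀ j, (if j = i then s.count j else 0) = 0 := fun j => by
      split_ifs with hj
      · subst hj; exact Multiset.count_eq_zero.2 hi
      · rfl
    simp [this]

/-- A partition of `3 * k + 2` whose product of parts exceeds `5 / 6` of the maximum `2 * 3 ^ k`
arises from `{2, 3, …, 3}` by `t` replacements of two parts `3` by three parts `2`, and by merging
pairs of parts `2` into parts `4`; its product is `(8 / 9) ^ t` of the maximum. -/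
theorem partition_two_mod {k : ℕ} {s : Multiset ℕ} (hs : s ∈ partitions (3 * k + 2)) :
    (s.prod : ℚ) ≤ 5 / 6 * (2 * 3 ^ k) ∨ ∃ x y z t,
      s = Multiset.replicate x 2 + Multiset.replicate y 3 + Multiset.replicate z 4 ∧
      x + 2 * z = 1 + 3 * t ∧ y + 2 * t = k ∧ (s.prod : ℚ) = (8 / 9) ^ t * (2 * 3 ^ k) := by
  obtain ⟨hsum, hpos⟩ := mem_partitions.1 hs
  -- a part `i` that is smaller than `maxProd i` by a factor `c` costs that factor
  have key : ∀ i ∈ s, ∀ c : ℚ, (i : ℚ) ≤ c * maxProd i → 0 ≤ c →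
      (s.prod : ℚ) ≤ c * (2 * 3 ^ k) := fun i hi c hc hc0 => by
    have h1 := Multiset.sum_erase hi
    have h3 := prod_le_maxProd (s.erase i)
    have h4 := maxProd_mul_le i (s.erase i).sum
    rw [h1, hsum, maxProd_two_mod] at h4
    rw [← Multiset.prod_erase hi, Nat.cast_mul]
    calc (i : ℚ) * (s.erase i).prod ≤ (c * maxProd i) * maxProd (s.erase i).sum :=
          mul_le_mul hc h3 (by positivity) (mul_nonneg hc0 (maxProd_pos i).le)
      _ = c * (maxProd i * maxProd (s.erase i).sum) := by ring
      _ ≤ c * (2 * 3 ^ k) := by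
          rw [mul_comm 2]
          exact mul_le_mul_of_nonneg_left h4 hc0
  by_cases h : ∀ i ∈ s, i = 2 ∨ i = 3 ∨ i = 4
  · right
    obtain ⟨x, y, z, rfl⟩ := eq_replicate_of_mem h
    have hsum' : x * 2 + y * 3 + z * 4 = 3 * k + 2 := by simpa using hsum
    obtain ⟨t, ht⟩ : ∃ t, x + 2 * z = 1 + 3 * t := ⟨(x + 2 * z) / 3, by omega⟩
    refine ⟨x, y, z, t, rfl, ht, by omega, ?_⟩
    have hk : k = y + 2 * t := by omega
    have h2 : (2 : ℚ) ^ x * 4 ^ z = 2 * 8 ^ t := by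
      have : (2 : ℚ) ^ (x + 2 * z) = 2 ^ (1 + 3 * t) := by rw [ht]
      rw [pow_add, pow_add, pow_mul, pow_mul] at this
      norm_num at this
      exact this
    have h9 : (3 : ℚ) ^ (2 * t) = 9 ^ t := by rw [pow_mul]; norm_num
    simp only [Multiset.prod_add, Multiset.prod_replicate]
    push_cast
    rw [hk, pow_add, h9, div_pow, mul_right_comm, h2]
    field_simp
  · left
    push Not at h
    obtain ⟨i, hi, h2, h3, h4⟩ := h
    have := hpos i hi
    rcases Nat.lt_or_ge i 5 with h5 | h5
    · obtain rfl : i = 1 := by omega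
      exact key 1 hi _ (by norm_num [maxProd]) (by norm_num)
    · exact key i hi _ (le_maxProd_of_five_le h5) (by norm_num)

theorem commNum_le_maxProd (r n : ℕ) : commNum (r + 1) n ≤ partNum n * maxProd n ^ r := by
  have := commNum_le_sum r n ∅ (maxProd_pos n).le fun s hs => Or.inr (by
    rw [← (mem_partitions.1 hs).1]; exact prod_le_maxProd s)
  simpa using this

/-! ### Comparison of the leading terms -/

theorem one_le_partNum (n : ℕ) : 1 ≤ partNum n := by
  rw [partNum]; exact_mod_cast Fintype.card_pos

theorem latticeRatio_three_ge (r : ℕ) : (3 : ℚ) ^ r / 3 ≤ latticeRatio (r + 1) 3 := by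
  have : (1 : ℚ) ≤ 3 ^ r := one_le_pow₀ (by norm_num)
  rw [latticeRatio_three]; linarith

/-- Bernoulli's inequality in the form in which the thresholds for `ℓ = r + 1` enter. -/
theorem le_pow_of_bernoulli {X c : ℚ} (hc : 0 < c) {r : ℕ} (h : 1 + c * (X - 1) ≤ (r + 1 : ℕ)) :
    X ≤ ((1 + 1 / c) ^ r : ℚ) := by
  have h1 := one_add_mul_le_pow (a := 1 / c) (by have := one_div_pos.2 hc; linarith) r
  refine le_trans ?_ h1
  have h2 : c * (X - 1) ≤ r := by push_cast at h; linarith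
  have h3 : X - 1 ≤ r / c := by rw [le_div_iff₀ hc]; linarith
  rw [mul_one_div]
  linarith

/-- The case `n = 3 * k`: here `maxProd n ^ 2 = 9 / 8 * (maxProd (n - 1) * maxProd (n + 1))`, so that
the single partition `{3, …, 3}` of `n` outweighs everything in `N(n - 1) * N(n + 1)`. -/
theorem commDelta_pos {k r : ℕ} (hk : 1 ≤ k) (hr : 1 ≤ r)
    (hX : (k ! : ℚ) ^ 2 * partNum (3 * k - 1) * partNum (3 * k + 1) * 9 ^ k ≤ (9 / 8) ^ r) :
    0 < commDelta (r + 1) (3 * k) := by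
  obtain ⟨m, rfl⟩ := Nat.exists_eq_add_of_le' hk
  have e1 : 3 * (m + 1) - 1 = 3 * m + 2 := by omega
  have hlow := sum_le_commNum (r + 1) (3 * (m + 1)) {(0, m + 1, 0)} (by simp)
  have hu1 := commNum_le_maxProd r (3 * m + 2)
  have hu2 := commNum_le_maxProd r (3 * (m + 1) + 1)
  have ht : (3 : ℚ) ^ r / 3 < latticeRatio (r + 1) 3 := by
    have : (1 : ℚ) < 3 ^ r := one_lt_pow₀ (by norm_num) (by omega)
    rw [latticeRatio_three]; linarith
  rw [maxProd_two_mod] at hu1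
  rw [maxProd_one_mod] at hu2
  rw [e1] at hX
  simp only [Finset.sum_singleton, pow_zero, Nat.factorial_zero, Nat.cast_one, div_one, one_mul,
    mul_one] at hlow
  rw [commDelta, e1, sub_pos]
  set P := partNum (3 * m + 2)
  set Q := partNum (3 * (m + 1) + 1)
  have hP : 1 ≤ P := one_le_partNum _
  have hQ : 1 ≤ Q := one_le_partNum _
  have h1 : ((3 : ℚ) ^ r / 3) ^ (m + 1) / (m + 1)! < commNum (r + 1) (3 * (m + 1)) :=
    lt_of_lt_of_le (by gcongr) hlow
  calc commNum (r + 1) (3 * m + 2) * commNum (r + 1) (3 * (m + 1) + 1)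
      ≤ (P * (3 ^ m * 2) ^ r) * (Q * (3 ^ (m + 1) * (4 / 3)) ^ r) :=
        mul_le_mul hu1 hu2 (commNum_nonneg _ _) (by positivity)
    _ = ((m + 1)! ^ 2 * P * Q * 9 ^ (m + 1)) / (9 / 8) ^ r *
          (((3 : ℚ) ^ r / 3) ^ (m + 1) / (m + 1)!) ^ 2 := by
        have e : ((3 : ℚ) ^ m * 2) ^ r * (3 ^ (m + 1) * (4 / 3)) ^ r =
            ((3 ^ r) ^ (m + 1)) ^ 2 / (9 / 8) ^ r := by
          rw [← mul_pow, pow_right_comm 3 r, pow_right_comm _ r, ← div_pow]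
          congr 1
          ring
        have h9 : (9 : ℚ) ^ (m + 1) = (3 ^ (m + 1)) ^ 2 := by rw [pow_right_comm]; norm_num
        rw [mul_mul_mul_comm, e, h9, div_pow (3 ^ r)]
        field_simp
    _ ≤ 1 * (((3 : ℚ) ^ r / 3) ^ (m + 1) / (m + 1)!) ^ 2 := by
        gcongr
        exact (div_le_one (by positivity)).2 hX
    _ < commNum (r + 1) (3 * (m + 1)) ^ 2 := by
        rw [one_mul]
        gcongr

/-- The case `n = 3 * k + 1`: here `maxProd (n - 1) * maxProd (n + 1) = 9 / 8 * maxProd n ^ 2`, so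
that the partitions `{3, …, 3}` of `n - 1` and `{2, 3, …, 3}` of `n + 1` are decisive. -/
theorem commDelta_neg_one_mod {k r : ℕ} (hr : 1 ≤ r)
    (hX : ((k ! : ℚ) * partNum (3 * k + 1)) ^ 2 * 2 * 9 ^ k ≤ (9 / 8) ^ r) :
    commDelta (r + 1) (3 * k + 1) < 0 := by
  have hl1 := sum_le_commNum (r + 1) (3 * k) {(0, k, 0)} (by simp)
  have hl2 := sum_le_commNum (r + 1) (3 * k + 2) {(1, k, 0)} (by simp; omega)
  have hu := commNum_le_maxProd r (3 * k + 1)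
  have hx : (2 : ℚ) ^ r / 2 < latticeRatio (r + 1) 2 := by
    have : (1 : ℚ) < 2 ^ r := one_lt_pow₀ (by norm_num) (by omega)
    rw [latticeRatio_two]; linarith
  have ht := latticeRatio_three_ge r
  rw [maxProd_one_mod] at hu
  simp only [Finset.sum_singleton, pow_zero, Nat.factorial_zero, Nat.cast_one, div_one, one_mul,
    mul_one, pow_one, Nat.factorial_one] at hl1 hl2
  rw [commDelta, Nat.add_sub_cancel, sub_neg, show 3 * k + 1 + 1 = 3 * k + 2 from rfl]
  set P := partNum (3 * k + 1)
  have hP : 1 ≤ P := one_le_partNum _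
  set c := ((3 : ℚ) ^ r / 3) ^ k / k ! with hc
  have hc0 : 0 < c := by positivity
  have h1 : c ≤ latticeRatio (r + 1) 3 ^ k / k ! := by rw [hc]; gcongr
  calc commNum (r + 1) (3 * k + 1) ^ 2 ≤ (P * (3 ^ k * (4 / 3)) ^ r) ^ 2 := by
        exact pow_le_pow_left₀ (commNum_nonneg _ _) hu _
    _ = (((k ! : ℚ) * P) ^ 2 * 2 * 9 ^ k) / (9 / 8) ^ r * (c * ((2 : ℚ) ^ r / 2 * c)) := by
        have e : (((3 : ℚ) ^ k * (4 / 3)) ^ r) ^ 2 =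
            ((3 ^ r) ^ k) ^ 2 * 2 ^ r / (9 / 8) ^ r := by
          rw [pow_right_comm _ r, pow_right_comm 3 r, pow_right_comm _ r, ← mul_pow, ← div_pow]
          congr 1
          ring
        have h9 : (9 : ℚ) ^ k = (3 ^ k) ^ 2 := by rw [pow_right_comm]; norm_num
        rw [mul_pow P, e, h9, hc, div_pow (3 ^ r)]
        field_simp
    _ ≤ 1 * (c * ((2 : ℚ) ^ r / 2 * c)) := by
        gcongr
        exact (div_le_one (by positivity)).2 hX
    _ = c * ((2 : ℚ) ^ r / 2 * c) := one_mul _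
    _ < c * (latticeRatio (r + 1) 2 * c) := by gcongr
    _ ≤ (latticeRatio (r + 1) 3 ^ k / k !) *
          (latticeRatio (r + 1) 2 * (latticeRatio (r + 1) 3 ^ k / k !)) := by
        have := latticeRatio_nonneg (r + 1) 2
        have := hc0.le.trans h1
        gcongr
    _ ≤ commNum (r + 1) (3 * k) * commNum (r + 1) (3 * k + 2) := by
        refine mul_le_mul hl1 hl2 ?_ (hc0.le.trans (h1.trans hl1))
        exact mul_nonneg (latticeRatio_nonneg _ _) (hc0.le.trans h1)

/-- The case `n = 3 * k + 2`, `k ≥ 7`. Now `maxProd n ^ 2 = maxProd (n - 1) * maxProd (n + 1)`, and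
the coefficients of the leading terms decide: the quotient of those of `N(n - 1) * N(n + 1)`
and of `N(n) ^ 2` is `7 * k / (6 * (k + 1)) ≥ 49 / 48`, against an error term that is smaller than
the leading term of `N(n)` by a factor of about `97`. -/
theorem commDelta_neg_two_mod {k r : ℕ} (hk : 7 ≤ k) (hr : 768 * k ≤ r)
    (hX : 97 * 2 ^ k * (k ! : ℚ) * partNum (3 * k + 2) ≤ (9 / 8) ^ r) :
    commDelta (r + 1) (3 * k + 2) < 0 := by
  have hu := commNum_le_sum r (3 * k + 2) {(1, k, 0)} (M := 8 / 9 * (2 * 3 ^ k)) (by positivity)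
    fun s hs => by
      rcases partition_two_mod hs with h | ⟨x, y, z, t, h, h1, h2, h3⟩
      · exact Or.inr (h.trans (mul_le_mul_of_nonneg_right (by norm_num) (by positivity)))
      · rcases Nat.eq_zero_or_pos t with rfl | ht
        · obtain rfl : x = 1 := by omega
          obtain rfl : z = 0 := by omega
          obtain rfl : y = k := by omega
          exact Or.inl ⟨_, Finset.mem_singleton_self _, h⟩
        · right
          rw [h3]
          gcongr
          exact pow_le_of_le_one (by norm_num) (by norm_num) ht.ne'
  obtain ⟨m, rfl⟩ := Nat.exists_eq_add_of_le' (show 1 ≤ k by omega)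
  have hl1 := sum_le_commNum (r + 1) (3 * (m + 1) + 1) {(2, m, 0), (0, m, 1)} (by
    simp only [Finset.mem_insert, Finset.mem_singleton]
    rintro x (rfl | rfl) <;> dsimp only <;> omega)
  have hl2 := sum_le_commNum (r + 1) (3 * (m + 1) + 2 + 1) {(0, m + 2, 0)} (by simp; omega)
  rw [Finset.sum_pair (by simp)] at hl1
  simp only [Finset.sum_singleton, pow_zero, Nat.factorial_zero, Nat.cast_one, div_one, one_mul,
    mul_one, pow_one, Nat.factorial_one, Nat.factorial_two, Nat.cast_ofNat] at hu hl1 hl2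
  rw [commDelta, show 3 * (m + 1) + 2 - 1 = 3 * (m + 1) + 1 from rfl, sub_neg]
  have ht := latticeRatio_three r
  have hx := latticeRatio_two r
  rw [latticeRatio_four] at hl1
  set t := latticeRatio (r + 1) 3
  set x := latticeRatio (r + 1) 2
  set P := partNum (3 * (m + 1) + 2)
  have hP : 1 ≤ P := one_le_partNum _
  have hrq : (768 * (m + 1) : ℚ) ≤ r := by exact_mod_cast hr
  have hm : (6 : ℚ) ≤ m := by exact_mod_cast (show 6 ≤ m by omega)
  have hA : (1 : ℚ) + r * 2 ≤ 3 ^ r :=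
    (one_add_mul_le_pow (a := (2 : ℚ)) (by norm_num) r).trans_eq (by norm_num)
  have hB : (1 : ℚ) + r * 1 ≤ 2 ^ r :=
    (one_add_mul_le_pow (a := (1 : ℚ)) (by norm_num) r).trans_eq (by norm_num)
  have ht0 : 0 < t := by linarith
  have hx0 : 0 < x := by linarith
  set D := x * (t ^ (m + 1) / (m + 1)!) with hD
  have hD0 : 0 < D := by positivity
  -- replacing `t` and `x` by `3 ^ r / 2` and `2 ^ r` changes the leading term only slightly
  have hDlow : 999 / 1000 * (2 ^ r * ((3 ^ r / 2) ^ (m + 1) / (m + 1)!)) ≤ D := by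
    have hx' : (1 - 1 / 10000) * 2 ^ r ≤ x := by linarith
    have ht' : t = (1 + -(1 / (3 * 3 ^ r))) * (3 ^ r / 2) := by rw [ht]; field_simp; ring
    have hsmall : (m + 1 : ℚ) * (1 / (3 * 3 ^ r)) ≤ 1 / 4000 := by
      rw [mul_one_div, div_le_iff₀ (by positivity)]
      linarith
    have hone : 1 / (3 * 3 ^ r) ≤ (1 : ℚ) := by
      rw [div_le_iff₀ (by positivity)]; linarith
    have hb := one_add_mul_le_pow (a := (-(1 / (3 * 3 ^ r)) : ℚ)) (by linarith) (m + 1)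
    push_cast at hb
    have hb' : (1 - 1 / 4000 : ℚ) ≤ (1 + -(1 / (3 * 3 ^ r))) ^ (m + 1) := by linarith
    rw [hD, ht', mul_pow]
    calc (999 / 1000 : ℚ) * (2 ^ r * ((3 ^ r / 2) ^ (m + 1) / (m + 1)!))
        ≤ ((1 - 1 / 10000) * (1 - 1 / 4000)) * (2 ^ r * ((3 ^ r / 2) ^ (m + 1) / (m + 1)!)) := by
          gcongr; norm_num
      _ = ((1 - 1 / 10000) * 2 ^ r) * (((1 - 1 / 4000) * (3 ^ r / 2) ^ (m + 1)) / (m + 1)!) := by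
          ring
      _ ≤ _ := by gcongr
  have hR : P * (8 / 9 * (2 * 3 ^ (m + 1))) ^ r ≤ D * (10 / 969) := by
    calc P * (8 / 9 * (2 * 3 ^ (m + 1))) ^ r
        = (97 * 2 ^ (m + 1) * ((m + 1)! : ℚ) * P) / (9 / 8) ^ r *
            (1 / 97 * (2 ^ r * ((3 ^ r / 2) ^ (m + 1) / (m + 1)!))) := by
          have e : (8 / 9 * (2 * (3 : ℚ) ^ (m + 1))) ^ r =
              2 ^ r * (3 ^ r) ^ (m + 1) / (9 / 8) ^ r := by
            rw [pow_right_comm 3 r, ← mul_pow, ← div_pow]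
            congr 1
            ring
          rw [e, div_pow (3 ^ r)]
          field_simp
      _ ≤ 1 * (1 / 97 * (2 ^ r * ((3 ^ r / 2) ^ (m + 1) / (m + 1)!))) := by
          gcongr
          exact (div_le_one (by positivity)).2 hX
      _ ≤ D * (10 / 969) := by linarith
  have hlow : D ^ 2 * (49 / 48) ≤
      commNum (r + 1) (3 * (m + 1) + 1) * commNum (r + 1) (3 * (m + 1) + 2 + 1) := by
    have h7 : 7 / 6 * x ^ 2 * (t ^ m / m !) ≤ commNum (r + 1) (3 * (m + 1) + 1) := by
      refine le_trans ?_ hl1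
      have : 0 ≤ x / 6 * (t ^ m / m !) := by positivity
      linarith
    refine le_trans ?_ (mul_le_mul h7 hl2 (by positivity) (commNum_nonneg _ _))
    have hq : 49 / 48 * (m + 1 : ℚ)⁻¹ ≤ 7 / 6 * (m + 2 : ℚ)⁻¹ := by
      rw [← div_eq_mul_inv, ← div_eq_mul_inv, div_le_div_iff₀ (by positivity) (by positivity)]
      linarith
    have e1 : ((m + 2)! : ℚ) = (m + 2) * ((m + 1) * m !) := by
      rw [Nat.factorial_succ, Nat.factorial_succ]; push_cast; ring
    have e2 : ((m + 1)! : ℚ) = (m + 1) * m ! := by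
      rw [Nat.factorial_succ]; push_cast; ring
    rw [hD, e1, e2]
    have hpos : 0 ≤ x ^ 2 * t ^ (2 * m + 2) / ((m + 1) * (m ! : ℚ) ^ 2) := by positivity
    calc (x * (t ^ (m + 1) / ((m + 1) * m !))) ^ 2 * (49 / 48)
        = (x ^ 2 * t ^ (2 * m + 2) / ((m + 1) * (m ! : ℚ) ^ 2)) * (49 / 48 * (m + 1 : ℚ)⁻¹) := by
          field_simp
          ring
      _ ≤ (x ^ 2 * t ^ (2 * m + 2) / ((m + 1) * (m ! : ℚ) ^ 2)) * (7 / 6 * (m + 2 : ℚ)⁻¹) :=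
          mul_le_mul_of_nonneg_left hq hpos
      _ = _ := by
          field_simp
          ring
  refine lt_of_le_of_lt (pow_le_pow_left₀ (commNum_nonneg _ _)
    (hu.trans (add_le_add_right hR _)) 2) (lt_of_lt_of_le ?_ hlow)
  have : 0 < D ^ 2 := by positivity
  nlinarith

/-! ### The second-order comparison for `n = 20` -/

/-- The comparison of second-order terms for `n = 20`. The leading terms `t ^ 12 * x ^ 2` cancel, and
the terms of order `t ^ 10 * x ^ 5` leave the surplus `211 / (3! * 6! * 7!)` on the right. In the application `A = 3 ^ r`, `B = 2 ^ r`,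
`δ = (15 / 16) ^ r`, while `t`, `x`, `a` are the lattice ratios at `3`, `2`, `4` and `p` is the number
of partitions of `20`. -/
theorem twenty_inequality {A B p δ t x a : ℚ} (hA : 10 ^ 6 ≤ A) (hB : 10 ^ 6 ≤ B) (hp : 1 ≤ p)
    (hδ0 : 0 < δ) (hδ : 10 ^ 8 * p ^ 2 * δ ≤ 1) (hAB : B ^ 3 ≤ δ * A ^ 2) (ht : t = A / 2 - 1 / 6)
    (hx : x = B - 1 / 2) (ha : a = 2 / 3 * x ^ 2 + x / 6) :
    (t ^ 6 * x / 720 + t ^ 4 / 24 * (x ^ 4 / 24 + x ^ 2 / 2 * a + a ^ 2 / 2) +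
      p * (A ^ 4 * B ^ 4 * δ)) ^ 2 <
    (t ^ 5 / 120 * (x ^ 2 / 2 + a) +
      t ^ 3 / 6 * (x ^ 5 / 120 + x ^ 3 / 6 * a + x * (a ^ 2 / 2))) *
    (t ^ 7 / 5040 + t ^ 5 / 120 * (x ^ 3 / 6 + x * a)) := by
  have hx0 : 0 < x := by linarith
  have ht0 : 0 < t := by linarith
  have hx5 : 10 ^ 5 ≤ x := by linarith
  have htA : t ≤ A / 2 := by linarith
  have hxB : x ≤ B := by linarith
  have htA' : 2 / 5 * A ≤ t := by linarith
  have hxB' : B / 2 ≤ x := by linarith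
  have hA0 : 0 < A := by linarith
  have hB0 : 0 < B := by linarith
  have hpδ : p * δ ≤ 1 / 10 ^ 8 := by
    have : p * δ ≤ p ^ 2 * δ := by
      gcongr
      exact le_self_pow₀ hp (by norm_num)
    linarith
  have hδ' : δ ≤ 1 / 10 ^ 8 := by
    have : 1 * δ ≤ p * δ := by gcongr
    linarith
  set S := A ^ 10 * B ^ 5 with hS
  have hS0 : 0 < S := by positivity
  set D := t ^ 6 * x / 720 with hD
  set E := t ^ 4 / 24 * (x ^ 4 / 24 + x ^ 2 / 2 * a + a ^ 2 / 2) with hE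
  set F := p * (A ^ 4 * B ^ 4 * δ) with hF
  have hD0 : 0 < D := by positivity
  have ha0 : 0 < a := by rw [ha]; positivity
  have hE0 : 0 < E := by positivity
  have hF0 : 0 < F := by positivity
  have hx3 : 10 ^ 5 * x ^ 3 ≤ x ^ 4 := by
    rw [pow_succ x 3, mul_comm]; gcongr
  have hx2 : 10 ^ 5 * x ^ 2 ≤ x ^ 3 := by
    rw [pow_succ x 2, mul_comm]; gcongr
  have hx4 : 10 ^ 5 * x ^ 4 ≤ x ^ 5 := by
    rw [pow_succ x 4, mul_comm]; gcongr
  have hE1 : E = t ^ 4 / 24 * (43 / 72 * x ^ 4 + 7 / 36 * x ^ 3 + x ^ 2 / 72) := by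
    rw [hE, ha]; ring
  have hx2' := pow_pos hx0 2
  have hEF : E + F ≤ A ^ 4 * B ^ 4 / 300 := by
    have h1 : E ≤ (A / 2) ^ 4 / 24 * B ^ 4 := by
      rw [hE1]
      have : 43 / 72 * x ^ 4 + 7 / 36 * x ^ 3 + x ^ 2 / 72 ≤ x ^ 4 := by linarith
      have h4 : x ^ 4 ≤ B ^ 4 := by gcongr
      have := this.trans h4
      gcongr
    have h2 : F ≤ A ^ 4 * B ^ 4 * (1 / 10 ^ 8) := by
      rw [hF, show p * (A ^ 4 * B ^ 4 * δ) = A ^ 4 * B ^ 4 * (p * δ) by ring]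
      gcongr
    have : 0 < A ^ 4 * B ^ 4 := by positivity
    linarith
  have hsq : (E + F) ^ 2 ≤ S / 10 ^ 12 := by
    calc (E + F) ^ 2 ≤ (A ^ 4 * B ^ 4 / 300) ^ 2 := by gcongr
      _ = A ^ 8 * B ^ 5 / 90000 * B ^ 3 := by ring
      _ ≤ A ^ 8 * B ^ 5 / 90000 * (δ * A ^ 2) := by gcongr
      _ = S / 90000 * δ := by rw [hS]; ring
      _ ≤ S / 90000 * (1 / 10 ^ 8) := by gcongr
      _ ≤ S / 10 ^ 12 := by linarith
  have hDF : 2 * D * F ≤ S / 10 ^ 12 := by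
    calc 2 * D * F ≤ 2 * ((A / 2) ^ 6 * B / 720) * F := by rw [hD]; gcongr
      _ = S / 23040 * (p * δ) := by rw [hF, hS]; ring
      _ ≤ S / 23040 * (1 / 10 ^ 8) := by gcongr
      _ ≤ S / 10 ^ 12 := by linarith
  have hP : 3 / 10 ^ 6 * S ≤ t ^ 10 * x ^ 5 := by
    calc 3 / 10 ^ 6 * S ≤ (2 / 5 * A) ^ 10 * (B / 2) ^ 5 := by rw [hS]; ring_nf; linarith
      _ ≤ t ^ 10 * x ^ 5 := by gcongr
  have hmain : D ^ 2 + 2 * D * E + 9 / 10 ^ 6 * (t ^ 10 * x ^ 5) ≤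
      (t ^ 5 / 120 * (x ^ 2 / 2 + a) +
        t ^ 3 / 6 * (x ^ 5 / 120 + x ^ 3 / 6 * a + x * (a ^ 2 / 2))) *
      (t ^ 7 / 5040 + t ^ 5 / 120 * (x ^ 3 / 6 + x * a)) := by
    have h1 : t ^ 5 / 120 * (7 / 6 * x ^ 2) + t ^ 3 / 6 * (41 / 120 * x ^ 5) ≤
        t ^ 5 / 120 * (x ^ 2 / 2 + a) +
          t ^ 3 / 6 * (x ^ 5 / 120 + x ^ 3 / 6 * a + x * (a ^ 2 / 2)) := by
      have : 0 ≤ t ^ 5 / 120 * (x / 6) + t ^ 3 / 6 * (x ^ 4 * (5 / 36) + x ^ 3 / 72) := by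
        positivity
      rw [ha]
      linarith
    have h2 : t ^ 7 / 5040 + t ^ 5 / 120 * (5 / 6 * x ^ 3) ≤
        t ^ 7 / 5040 + t ^ 5 / 120 * (x ^ 3 / 6 + x * a) := by
      have : 0 ≤ t ^ 5 / 120 * (x ^ 2 / 6) := by positivity
      rw [ha]
      linarith
    refine le_trans ?_ (mul_le_mul h1 h2 (by positivity) (by positivity))
    rw [hD, hE1]
    have h3 : 0 ≤ t ^ 8 * x ^ 8 * (41 / 720 * (1 / 144)) := by positivity
    have h4 : t ^ 10 * (10 ^ 5 * x ^ 4) ≤ t ^ 10 * x ^ 5 := by gcongr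
    have h5 : t ^ 10 * (10 ^ 5 * x ^ 3) ≤ t ^ 10 * x ^ 4 := by gcongr
    linarith
  nlinarith

/-- For `n = 20` the leading terms agree up to a positive remainder, since
`7 * k / (6 * (k + 1)) = 1` for `k = 6`, and the partitions with product
`8 / 9` of the maximum have to be taken into account as well. -/
theorem commDelta_neg_twenty {r : ℕ} (hr : 10 ^ 6 ≤ r)
    (hX : 10 ^ 8 * partNum 20 ^ 2 ≤ (16 / 15) ^ r) : commDelta (r + 1) 20 < 0 := by
  have hu := commNum_le_sum r 20 {(1, 6, 0), (4, 4, 0), (2, 4, 1), (0, 4, 2)}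
    (M := 1215) (by positivity) fun s hs => by
      rcases partition_two_mod (k := 6) hs with h | ⟨x, y, z, t, h, h1, h2, h3⟩
      · exact Or.inr (h.trans (by norm_num))
      · rcases Nat.lt_or_ge t 2 with ht | ht
        · left
          refine ⟨(x, y, z), ?_, h⟩
          simp only [Finset.mem_insert, Finset.mem_singleton, Prod.mk.injEq]
          omega
        · right
          rw [h3]
          have : (8 / 9 : ℚ) ^ t ≤ (8 / 9) ^ 2 :=
            pow_le_pow_of_le_one (by norm_num) (by norm_num) ht
          linarith
  have hl1 := sum_le_commNum (r + 1) 19 {(2, 5, 0), (0, 5, 1), (5, 3, 0), (3, 3, 1), (1, 3, 2)}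
    (by decide)
  have hl2 := sum_le_commNum (r + 1) 21 {(0, 7, 0), (3, 5, 0), (1, 5, 1)} (by decide)
  have ha := latticeRatio_four r
  have hx := latticeRatio_two r
  have ht := latticeRatio_three r
  have hrq : (10 ^ 6 : ℚ) ≤ r := by exact_mod_cast hr
  have hA : (1 : ℚ) + r * 2 ≤ 3 ^ r :=
    (one_add_mul_le_pow (a := (2 : ℚ)) (by norm_num) r).trans_eq (by norm_num)
  have hB : (1 : ℚ) + r * 1 ≤ 2 ^ r :=
    (one_add_mul_le_pow (a := (1 : ℚ)) (by norm_num) r).trans_eq (by norm_num)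
  have hAB : ((2 : ℚ) ^ r) ^ 3 ≤ (15 / 16) ^ r * (3 ^ r) ^ 2 := by
    rw [← pow_mul, ← pow_mul, mul_comm r 3, mul_comm r 2, pow_mul, pow_mul, ← mul_pow]
    exact pow_le_pow_left₀ (by norm_num) (by norm_num) _
  -- `1215 = 15 / 16 * (3 ^ 4 * 2 ^ 4)` compares the remaining partitions with the second products
  have hM : (1215 : ℚ) ^ r = (3 ^ r) ^ 4 * (2 ^ r) ^ 4 * (15 / 16) ^ r := by
    rw [← pow_mul, ← pow_mul, mul_comm r 4, pow_mul, pow_mul, ← mul_pow, ← mul_pow]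
    norm_num
  have hδ : 10 ^ 8 * partNum 20 ^ 2 * (15 / 16) ^ r ≤ 1 := by
    have h0 : (0 : ℚ) < (15 / 16) ^ r := by positivity
    have h1 : ((16 / 15 : ℚ)) ^ r * (15 / 16) ^ r = 1 := by
      rw [← mul_pow]; norm_num
    rw [← h1]
    gcongr
  rw [commDelta, show 20 - 1 = 19 from rfl, show 20 + 1 = 21 from rfl, sub_neg]
  rw [Finset.sum_insert (by decide), Finset.sum_insert (by decide), Finset.sum_insert (by decide),
    Finset.sum_insert (by decide), Finset.sum_singleton] at hl1
  rw [Finset.sum_insert (by decide), Finset.sum_insert (by decide), Finset.sum_singleton] at hl2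
  rw [Finset.sum_insert (by decide), Finset.sum_insert (by decide), Finset.sum_insert (by decide),
    Finset.sum_singleton, hM] at hu
  simp only [Nat.factorial, Nat.succ_eq_add_one, Nat.cast_one, Nat.cast_mul, Nat.cast_add,
    Nat.cast_ofNat, pow_zero, pow_one] at hu hl1 hl2
  norm_num at hu hl1 hl2
  have key := twenty_inequality (by linarith) (by linarith) (one_le_partNum 20) (by positivity)
    hδ hAB ht hx ha
  have hx0 := latticeRatio_nonneg (r + 1) 2
  have ht0 := latticeRatio_nonneg (r + 1) 3
  have ha0 := latticeRatio_nonneg (r + 1) 4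
  refine lt_of_le_of_lt (pow_le_pow_left₀ (commNum_nonneg _ _) (hu.trans_eq ?_) 2)
    (lt_of_lt_of_le key (mul_le_mul (le_trans (le_of_eq ?_) hl1) (le_trans (le_of_eq ?_) hl2)
      (by positivity) (commNum_nonneg _ _)))
  all_goals ring

/-! ### The thresholds -/

theorem mainTheorem2 (n ℓ : ℕ) (hn : 1 ≤ n) (hℓ : kappa n ≤ (ℓ : ℚ)) :
    (n ≡ 0 [MOD 3] → 0 < commDelta ℓ n) ∧
    (n ≡ 1 [MOD 3] → commDelta ℓ n < 0) ∧
    (n ≡ 2 [MOD 3] → 20 ≤ n → commDelta ℓ n < 0) := by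
  refine ⟨fun h => ?_, fun h => ?_, fun h h20 => ?_⟩
  · obtain ⟨k, rfl⟩ : ∃ k, n = 3 * k := ⟨n / 3, by have : n % 3 = 0 % 3 := h; omega⟩
    rw [kappa, if_pos (by omega), Nat.mul_div_cancel_left k (by norm_num), zpow_neg, div_inv_eq_mul,
      zpow_natCast, pow_mul, show (3 : ℚ) ^ 2 = 9 by norm_num] at hℓ
    set X := (k ! : ℚ) ^ 2 * partNum (3 * k - 1) * partNum (3 * k + 1) * 9 ^ k with hX
    have hX9 : 9 ≤ X := by
      have h1 := one_le_partNum (3 * k - 1)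
      have h2 := one_le_partNum (3 * k + 1)
      have h3 : (1 : ℚ) ≤ k ! := by exact_mod_cast Nat.factorial_pos k
      have h4 : (9 : ℚ) ≤ 9 ^ k := le_self_pow₀ (by norm_num) (by omega)
      calc (9 : ℚ) = 1 ^ 2 * 1 * 1 * 9 := by norm_num
        _ ≤ X := by rw [hX]; gcongr
    have hℓ2 : (2 : ℚ) ≤ ℓ := by linarith
    obtain ⟨r, rfl⟩ := Nat.exists_eq_add_of_le' (show 1 ≤ ℓ by
      have : 2 ≤ ℓ := by exact_mod_cast hℓ2
      omega)
    refine commDelta_pos (by omega) (by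
      have : 2 ≤ r + 1 := by exact_mod_cast hℓ2
      omega) ?_
    exact (le_pow_of_bernoulli (by norm_num) hℓ).trans_eq (by norm_num)
  · obtain ⟨k, rfl⟩ : ∃ k, n = 3 * k + 1 := ⟨n / 3, by have : n % 3 = 1 % 3 := h; omega⟩
    rw [kappa, if_neg (by omega), if_pos (by omega), Nat.add_sub_cancel,
      Nat.mul_div_cancel_left k (by norm_num), pow_mul, show (3 : ℚ) ^ 2 = 9 by norm_num] at hℓ
    set X := ((k ! : ℚ) * partNum (3 * k + 1)) ^ 2 * 2 * 9 ^ k with hX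
    have hX2 : 2 ≤ X := by
      have h2 := one_le_partNum (3 * k + 1)
      have h3 : (1 : ℚ) ≤ k ! := by exact_mod_cast Nat.factorial_pos k
      have h4 : (1 : ℚ) ≤ 9 ^ k := one_le_pow₀ (by norm_num)
      calc (2 : ℚ) = (1 * 1) ^ 2 * 2 * 1 := by norm_num
        _ ≤ X := by rw [hX]; gcongr
    have hℓ2 : (2 : ℚ) ≤ ℓ := by linarith
    obtain ⟨r, rfl⟩ := Nat.exists_eq_add_of_le' (show 1 ≤ ℓ by
      have : 2 ≤ ℓ := by exact_mod_cast hℓ2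
      omega)
    refine commDelta_neg_one_mod (by
      have : 2 ≤ r + 1 := by exact_mod_cast hℓ2
      omega) ?_
    exact (le_pow_of_bernoulli (by norm_num) hℓ).trans_eq (by norm_num)
  · obtain ⟨k, rfl⟩ : ∃ k, n = 3 * k + 2 := ⟨n / 3, by have : n % 3 = 2 % 3 := h; omega⟩
    rcases eq_or_ne k 6 with rfl | hk6
    · rw [kappa, if_neg (by omega), if_neg (by omega), if_neg (by omega), if_neg (by omega),
        if_pos (by omega)] at hℓ
      change commDelta ℓ 20 < 0
      have hp := one_le_partNum 20
      generalize hY : (((3 ! : ℕ) * (6 ! : ℕ) * (7 ! : ℕ) * (2 : ℚ) ^ 10) / 211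
        * ((1 / ((6 ! : ℕ) * (2 : ℚ) ^ 6) + partNum 20) ^ 2
          + partNum 20 / ((6 ! : ℕ) * (2 : ℚ) ^ 5))) = Y at hℓ
      have hYp : 10 ^ 8 * partNum 20 ^ 2 ≤ Y := by
        rw [← hY]
        norm_num [Nat.factorial]
        nlinarith
      have hY8 : (10 ^ 8 : ℚ) ≤ Y := by nlinarith
      have hℓ2 : ((10 ^ 6 + 1 : ℕ) : ℚ) ≤ ℓ := by push_cast; linarith
      have hℓ3 : 10 ^ 6 + 1 ≤ ℓ := by exact_mod_cast hℓ2
      obtain ⟨r, rfl⟩ := Nat.exists_eq_add_of_le' (show 1 ≤ ℓ by omega)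
      refine commDelta_neg_twenty (by omega) (hYp.trans ?_)
      exact (le_pow_of_bernoulli (by norm_num) hℓ).trans_eq (by norm_num)
    · have hk : 7 ≤ k := by omega
      rw [kappa, if_neg (by omega), if_neg (by omega), if_neg (by omega), if_neg (by omega),
        if_neg (by omega), Nat.add_sub_cancel, Nat.mul_div_cancel_left k (by norm_num)] at hℓ
      set X := 97 * (2 : ℚ) ^ k * (k ! : ℚ) * partNum (3 * k + 2) with hX
      have hXk : 97 * (k + 1 : ℚ) ≤ X := by
        have h2 := one_le_partNum (3 * k + 2)
        have h3 : (1 : ℚ) ≤ k ! := by exact_mod_cast Nat.factorial_pos k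
        have h4 : (k + 1 : ℚ) ≤ 2 ^ k := by exact_mod_cast Nat.lt_two_pow_self (n := k)
        calc 97 * (k + 1 : ℚ) = 97 * (k + 1 : ℚ) * 1 * 1 := by ring
          _ ≤ X := by rw [hX]; gcongr
      have hℓ2 : ((768 * k + 1 : ℕ) : ℚ) ≤ ℓ := by push_cast; linarith
      have hℓ3 : 768 * k + 1 ≤ ℓ := by exact_mod_cast hℓ2
      obtain ⟨r, rfl⟩ := Nat.exists_eq_add_of_le' (show 1 ≤ ℓ by omega)
      refine commDelta_neg_two_mod hk (by omega) ?_
      exact (le_pow_of_bernoulli (by norm_num) hℓ).trans_eq (by norm_num)
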